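/- **Setting (TTSV model).** Let $(\Omega,\mathcal A,\mathbb P)$ be a probability space and $\mathcal F_t=\sigma(Z_1(s),\dots,Z_m(s):0\le s\le t)$ the filtration generated by finitely many real-valued processes $Z_1,\dots,Z_m$. Let - $N=\{N(t)\}_{t\ge0}$ be an $\mathcal F_t$-adapted counting process ($N(0)=0$, right-continuous, jumps of size one at the arrival times $t_1<t_2<\dots$) with a positive, $\mathcal F_t$-predictable intensity $\lambda$ that is left-continuous with right-hand limits and satisfies $\int_0^t\lambda(s)\,ds<\infty$ a.s. for all $t$; that is, $\mathbb E\int_{(0,t]}C(r)\,dN(r)=\mathbb E\int_0^tC(r)\lambda(r)\,dr$ for every nonnegative $\mathcal F_t$-predictable process $C$; - $B$ be a Brownian motion such that $B(N(t))$ is $\mathcal F_t$-adapted; - $\varsigma$ be a positive, continuous, $\mathcal F_t$-predictable process; - $dP(t)=\varsigma(t)\,dB(N(t))$ on $[0,T]$, i.e. a.s. $P(t)=P(0)+\sum_{0<t_i\le t}\varsigma(t_i)U_i$ for all $t\in[0,T]$, where $U_i=B(N(t_i))-B(N(t_{i-1}))$ and $t_0=0$. Assume that the process $B$ is independent of the triple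 of processes $(\lambda,\varsigma,N)$, and that for all $t\in[0,T]$ the expectations $\mathbb E[\int_t^T\varsigma^2(r)\lambda(r)\,dr\mid\mathcal F_t]$, $\mathbb E[\varsigma^4(t)]$ and $\mathbb E[\int_0^t\varsigma^4(r)\lambda(r)\,dr]$ are finite (the first one a.s.). For $0\le s\le t\le T$ put $$\operatorname{IV}(s,t)=\int_s^t\varsigma^2(r)\lambda(r)\,dr,\qquad \operatorname{IQ}(s,t)=\int_s^t\varsigma^4(r)\lambda(r)\,dr,\qquad \operatorname{rIV}(s,t)=\int_{(s,t]}\varsigma^2(r)\,dN(r)=\sum_{s<t_i\le t}\varsigma^2(t_i),$$ $$\mathcal F^{\lambda,\varsigma}_T=\sigma(\lambda(s),\varsigma(s):0\le s\le T),\qquad \mathcal F^{\lambda,\varsigma,N}_T=\sigma(\lambda(s),\varsigma(s),N(s):0\le s\le T).$$ Let $M$ be a fixed natural number, let $\boldsymbol\tau=(\tau_0,\dots,\tau_M)$ be random sampling times with $0=\tau_0\le\tau_1\le\dots\le\tau_M=T$, and let $\operatorname{RV}(\boldsymbol\tau)=\sum_{j=1}^M\big(P(\tau_j)-P(\tau_{j-1})\big)^2$.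 Conditional expectations of nonnegative variables are understood in the generalized sense, with values in $[0,\infty]$. **Theorem.** (a) If $\tau_0,\dots,\tau_M$ are $\mathcal F^{\lambda,\varsigma,N}_T$-measurable, then almost surely $$\mathbb E\big[(\operatorname{RV}(\boldsymbol\tau)-\operatorname{IV}(0,T))^2\,\big|\,\mathcal F^{\lambda,\varsigma,N}_T\big]=\big(\operatorname{rIV}(0,T)-\operatorname{IV}(0,T)\big)^2+2\sum_{j=1}^M\operatorname{rIV}(\tau_{j-1},\tau_j)^2 .$$ (b) Suppose in addition that $\lambda$ is continuous, that $N$ is a doubly stochastic Poisson process with intensity $\lambda$ (for $s\le t$, given the whole path of $\lambda$ and the path of $N$ up to time $s$, the increment $N(t)-N(s)$ is Poisson distributed with parameter $\int_s^t\lambda(r)\,dr$), and that $\varsigma$ is independent of the pair of processes $(\lambda,N)$. If $\tau_0,\dots,\tau_M$ are $\mathcal F^{\lambda,\varsigma}_T$-measurable, then almost surely $$\mathbb E\big[(\operatorname{RV}(\boldsymbol\tau)-\operatorname{IV}(0,T))^2\,\big|\,\mathcal F^{\lambda,\varsigma}_T\big]=3\operatorname{IQ}(0,T)+2\sum_{j=1}^M\operatorname{IV}(\tau_{j-1},\tau_j)^2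 .$$ -/

import Mathlib

open MeasureTheory ProbabilityTheory Set Filter Topology
open scoped NNReal ENNReal

namespace TTSV

noncomputable section

variable {Ω : Type*}

/-- `σ(X(s) : 0 ≤ s ≤ t)`, the information carried by the process `X` up to time `t`. -/
abbrev history {E : Type*} [MeasurableSpace E] (X : ℝ≥0 → Ω → E) (t : ℝ≥0) : MeasurableSpace Ω :=
  ⨆ s ≤ t, MeasurableSpace.comap (X s) inferInstance

/-- `σ(X(s) : s ≥ 0)`, the information carried by the whole process `X`. -/
abbrev fullHistory {E : Type*} [MeasurableSpace E] (X : ℝ≥0 → Ω → E) : MeasurableSpace Ω :=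
  ⨆ s, MeasurableSpace.comap (X s) inferInstance

/-- `𝓕^{λ,ς}_t = σ(λ(s), ς(s) : 0 ≤ s ≤ t)`. -/
abbrev latentInfo (lam sig : ℝ≥0 → Ω → ℝ) (t : ℝ≥0) : MeasurableSpace Ω :=
  history (fun s ω => (lam s ω, sig s ω)) t

/-- `𝓕^{λ,ς,N}_t = σ(λ(s), ς(s), N(s) : 0 ≤ s ≤ t)`. -/
abbrev realizedInfo (lam sig : ℝ≥0 → Ω → ℝ) (N : ℝ≥0 → Ω → ℕ) (t : ℝ≥0) : MeasurableSpace Ω :=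
  history (fun s ω => (lam s ω, sig s ω, N s ω)) t

/-! ### Counting processes and integrals along their jumps -/

/-- The paths of a (simple, non-explosive) counting process: they start at `0`, are increasing,
right-continuous, and have jumps of size one. -/
structure IsCountingProcess (N : ℝ≥0 → Ω → ℕ) : Prop where
  zero : ∀ ω, N 0 ω = 0
  mono : ∀ ω, Monotone fun t => N t ω
  rightCont : ∀ ω t, ContinuousWithinAt (fun s => N s ω) (Ici t) t
  unitJumps : ∀ ω t, 0 < t → ∃ s < t, N t ω ≤ N s ω + 1

/-- The arrival time `t_i = inf {t ≥ 0 : N(t) ≥ i}` (so `t_0 = 0`); it is only ever used for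
indices `i` that are reached by the path. -/
def arrivalTime (N : ℝ≥0 → Ω → ℕ) (i : ℕ) (ω : Ω) : ℝ≥0 :=
  sInf {t | i ≤ N t ω}

/-- The pathwise integral `∫_{(s,t]} f(r) dN(r) = ∑_{s < t_i ≤ t} f(t_i)`. The arrivals in
`(s, t]` are those with index `N(s) < i ≤ N(t)`. -/
def jumpIntegral {E : Type*} [AddCommMonoid E] (N : ℝ≥0 → Ω → ℕ) (f : ℝ≥0 → Ω → E)
    (s t : ℝ≥0) (ω : Ω) : E :=
  ∑ i ∈ Finset.Ioc (N s ω) (N t ω), f (arrivalTime N i ω) ω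

/-- `U_i = B(N(t_i)) - B(N(t_{i-1}))`, the jump of the time-changed process `B ∘ N` at the
`i`-th arrival (`i ≥ 1`). -/
def tickIncrement (B : ℝ≥0 → Ω → ℝ) (N : ℝ≥0 → Ω → ℕ) (i : ℕ) (ω : Ω) : ℝ :=
  B (N (arrivalTime N i ω) ω : ℝ≥0) ω - B (N (arrivalTime N (i - 1) ω) ω : ℝ≥0) ω

/-- The pathwise integral `∫_{(s,t]} ς(r) dB(N(r)) = ∑_{s < t_i ≤ t} ς(t_i) U_i`. -/
def timeChangedIntegral (B : ℝ≥0 → Ω → ℝ) (N : ℝ≥0 → Ω → ℕ) (sig : ℝ≥0 → Ω → ℝ)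
    (s t : ℝ≥0) (ω : Ω) : ℝ :=
  ∑ i ∈ Finset.Ioc (N s ω) (N t ω), sig (arrivalTime N i ω) ω * tickIncrement B N i ω

/-- `N` has the `𝓕`-intensity `λ`: for every nonnegative `𝓕`-predictable process `C` and every
`t ≥ 0`, `E ∫_{(0,t]} C(r) dN(r) = E ∫_0^t C(r) λ(r) dr`. -/
def HasIntensity {mΩ : MeasurableSpace Ω} (μ : Measure Ω) (𝓕 : Filtration ℝ≥0 mΩ)
    (N : ℝ≥0 → Ω → ℕ) (lam : ℝ≥0 → Ω → ℝ) : Prop :=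
  ∀ C : ℝ≥0 → Ω → ℝ≥0∞, Measurable[𝓕.predictable] (Function.uncurry C) → ∀ t : ℝ≥0,
    ∫⁻ ω, jumpIntegral N C 0 t ω ∂μ =
      ∫⁻ ω, (∫⁻ r in Ioc 0 (t : ℝ), C r.toNNReal ω * ENNReal.ofReal (lam r.toNNReal ω)) ∂μ

/-! ### The model -/

/-- The tick-time stochastic volatility model `dP(t) = ς(t) dB(N(t))` on `[0, T]`, with respect to
the filtration `𝓕_t = σ(Z_1(s), …, Z_m(s) : s ≤ t)` generated by finitely many stochastic factors
(the process `Z = (Z_1, …, Z_m)`). -/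
structure IsTTSVModel {mΩ : MeasurableSpace Ω} (μ : Measure Ω) (T : ℝ≥0) {m : ℕ}
    (Z : ℝ≥0 → Ω → Fin m → ℝ) (hZ : ∀ t, StronglyMeasurable (Z t))
    (B : ℝ≥0 → Ω → ℝ) (N : ℝ≥0 → Ω → ℕ) (lam sig P : ℝ≥0 → Ω → ℝ) : Prop where
  counting : IsCountingProcess N
  N_adapted : Adapted (Filtration.natural Z hZ) N
  lam_pos : ∀ t ω, 0 < lam t ω
  lam_predictable : IsStronglyPredictable (Filtration.natural Z hZ) lam
  lam_leftCont : ∀ ω t, ContinuousWithinAt (fun s => lam s ω) (Iic t) t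
  lam_rightLim : ∀ ω t, ∃ l : ℝ, Tendsto (fun s => lam s ω) (𝓝[>] t) (𝓝 l)
  lam_integrable : ∀ t : ℝ≥0, ∀ᵐ ω ∂μ,
    ∫⁻ r in Ioc 0 (t : ℝ), ENNReal.ofReal (lam r.toNNReal ω) < ∞
  intensity : HasIntensity μ (Filtration.natural Z hZ) N lam
  B_measurable : ∀ t, Measurable (B t)
  B_brownian : IsBrownianReal B μ
  BN_adapted : Adapted (Filtration.natural Z hZ) fun t ω => B (N t ω : ℝ≥0) ω
  sig_pos : ∀ t ω, 0 < sig t ω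
  sig_continuous : ∀ ω, Continuous fun t => sig t ω
  sig_predictable : IsStronglyPredictable (Filtration.natural Z hZ) sig
  P_measurable : ∀ t, Measurable (P t)
  price : ∀ᵐ ω ∂μ, ∀ t ≤ T, P t ω = P 0 ω + timeChangedIntegral B N sig 0 t ω

/-- The Brownian motion `B` is independent of the processes `N`, `ς` and `λ` (jointly). -/
def IndependentDriver {mΩ : MeasurableSpace Ω} (μ : Measure Ω)
    (B : ℝ≥0 → Ω → ℝ) (N : ℝ≥0 → Ω → ℕ) (lam sig : ℝ≥0 → Ω → ℝ) : Prop :=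
  IndepFun (fun ω t => B t ω) (fun ω t => (lam t ω, sig t ω, N t ω)) μ

/-- For all `t ∈ [0,T]`, the expectations `E[∫_t^T ς² λ dr | 𝓕_t]`, `E[ς(t)⁴]` and
`E[∫_0^t ς⁴ λ dr]` are finite. -/
structure MomentConditions {mΩ : MeasurableSpace Ω} (μ : Measure Ω) (𝓕 : Filtration ℝ≥0 mΩ)
    (T : ℝ≥0) (lam sig : ℝ≥0 → Ω → ℝ) : Prop where
  condVariance : ∀ t ≤ T, ∀ᵐ ω ∂μ,
    (μ⁻[fun ω' => ∫⁻ r in Ioc (t : ℝ) T,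
      ENNReal.ofReal (sig r.toNNReal ω' ^ 2 * lam r.toNNReal ω') | 𝓕 t]) ω < ∞
  fourthMoment : ∀ t ≤ T, ∫⁻ ω, ENNReal.ofReal (sig t ω ^ 4) ∂μ < ∞
  quarticity : ∀ t ≤ T, ∫⁻ ω, (∫⁻ r in Ioc 0 (t : ℝ),
    ENNReal.ofReal (sig r.toNNReal ω ^ 4 * lam r.toNNReal ω)) ∂μ < ∞

/-- `N` is a doubly stochastic Poisson process directed by the continuous intensity `λ`: given the
whole path of `λ` and the path of `N` up to time `s`, the increment `N(t) - N(s)` is Poisson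
distributed with parameter `∫_s^t λ(r) dr`. -/
structure IsDoublyStochasticPoisson {mΩ : MeasurableSpace Ω} (μ : Measure Ω)
    (N : ℝ≥0 → Ω → ℕ) (lam : ℝ≥0 → Ω → ℝ) : Prop where
  lam_continuous : ∀ ω, Continuous fun t => lam t ω
  poisson : ∀ s t : ℝ≥0, s ≤ t → ∀ k : ℕ,
    μ[{ω | N t ω = N s ω + k}.indicator (fun _ => (1 : ℝ)) | fullHistory lam ⊔ history N s]
      =ᵐ[μ] fun ω =>
        Real.exp (-∫ r in (s : ℝ)..t, lam r.toNNReal ω) *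
          (∫ r in (s : ℝ)..t, lam r.toNNReal ω) ^ k / (k.factorial : ℝ)

/-! ### Sampling, realized variance and the integrated quantities -/

/-- A (possibly random) sampling grid `0 = τ_0 ≤ τ_1 ≤ … ≤ τ_M = T`. -/
structure IsSamplingGrid (T : ℝ≥0) {M : ℕ} (τ : Fin (M + 1) → Ω → ℝ≥0) : Prop where
  first : ∀ ω, τ 0 ω = 0
  last : ∀ ω, τ (Fin.last M) ω = T
  mono : ∀ ω, Monotone fun j => τ j ω

/-- Realized variance `RV(τ) = ∑_{j=1}^M (P(τ_j) - P(τ_{j-1}))²`. -/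
def RV (P : ℝ≥0 → Ω → ℝ) {M : ℕ} (τ : Fin (M + 1) → Ω → ℝ≥0) (ω : Ω) : ℝ :=
  ∑ j : Fin M, (P (τ j.succ ω) ω - P (τ j.castSucc ω) ω) ^ 2

/-- Integrated variance `IV(s,t) = ∫_s^t ς(r)² λ(r) dr`. -/
def IV (lam sig : ℝ≥0 → Ω → ℝ) (s t : ℝ≥0) (ω : Ω) : ℝ :=
  ∫ r in (s : ℝ)..t, sig r.toNNReal ω ^ 2 * lam r.toNNReal ω

/-- Integrated quarticity `IQ(s,t) = ∫_s^t ς(r)⁴ λ(r) dr`. -/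
def IQ (lam sig : ℝ≥0 → Ω → ℝ) (s t : ℝ≥0) (ω : Ω) : ℝ :=
  ∫ r in (s : ℝ)..t, sig r.toNNReal ω ^ 4 * lam r.toNNReal ω

/-- Realized integrated variance `rIV(s,t) = ∫_{(s,t]} ς(r)² dN(r)`. -/
def rIV (N : ℝ≥0 → Ω → ℕ) (sig : ℝ≥0 → Ω → ℝ) (s t : ℝ≥0) (ω : Ω) : ℝ :=
  jumpIntegral N (fun r ω' => sig r ω' ^ 2) s t ω

end

end TTSV

namespace TTSV

/-! ### Gaussian quadratic forms -/

/-! Part (a) is a Gaussian computation with frozen coefficients. At the arrivals the time-changed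
motion jumps by the unit increments ξ_k = B(k+1) - B(k), which are i.i.d. standard normal and
independent of (λ, ς, N). Hence P(τ_j) - P(τ_{j-1}) is the sum of ς(t_{k+1}) ξ_k over the block
N(τ_{j-1}) ≤ k < N(τ_j). Coefficients, blocks and IV are all measurable for the realized
information. With these fixed, disjoint blocks give independent centred normals X_j with variances
v_j = rIV(τ_{j-1}, τ_j), and Var(X_j²) = 2 v_j². The mean square of ∑ X_j² - IV is therefore its
squared bias (rIV - IV)² plus the variance 2 ∑ v_j². `lintegral_sq_sum_sq_sub` is the frozen
statement, and `setLIntegral_sq_RV_sub_IV` transfers it to the model by independence.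

Part (b) projects the right side of (a) onto the latent information, which requires the first two
conditional moments of rIV given (λ, ς). For a doubly stochastic Poisson process these are
Campbell's formulas: the mean is IV and the second moment is IV² + IQ. Thus (rIV - IV)² contributes
IQ, and block j contributes 2 (IV_j² + IQ_j). Since the IQ_j add up to IQ, the total is 3 IQ + 2 ∑
IV_j².

Because the τ_j are random, the formulas are needed for integrands depending on the paths of λ and
ς. They are obtained by comparing measures: the conditional Poisson law gives the weighted moments
of N(s) and N(s) N(t) at fixed times, independence of ς admits events of its path as further
weights, and a π-system argument passes from intervals to arbitrary jointly measurable integrands.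
-/

theorem integral_pow_four_gaussianReal (v : ℝ≥0) :
    ∫ x, x ^ 4 ∂gaussianReal 0 v = 3 * (v : ℝ) ^ 2 := by
  have h1 : ∫ x, x ^ 4 ∂gaussianReal 0 v
      = iteratedDeriv 4 (mgf (fun x ↦ x) (gaussianReal 0 v)) 0 := by
    rw [iteratedDeriv_mgf_zero] <;> simp
  -- Differentiation acts linearly on coefficients of (cubic polynomial) · exp(v t²/2); `h4` kills
  -- the t⁴ term that would leave this class. The rule covers three derivatives of the moment
  -- generating function. The fourth leaves the class and is evaluated only at 0.
  have hd (a b c d a' b' c' d' : ℝ) (h0 : a' = b) (h1 : b' = 2 * c + v * a)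
      (h2 : c' = 3 * d + v * b) (h3 : d' = v * c) (h4 : v * d = 0) :
      deriv (fun t : ℝ ↦ (a + b * t + c * t ^ 2 + d * t ^ 3) * Real.exp (0 * t + v * t ^ 2 / 2))
        = fun t ↦ (a' + b' * t + c' * t ^ 2 + d' * t ^ 3)
          * Real.exp (0 * t + v * t ^ 2 / 2) := by
    ext t
    have he : HasDerivAt (fun t : ℝ ↦ 0 * t + v * t ^ 2 / 2) (v * t) t :=
      (((hasDerivAt_id t).const_mul 0).fun_add
        (((hasDerivAt_pow 2 t).const_mul (v : ℝ)).div_const 2)).congr_deriv (by simp; ring)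
    have hp : HasDerivAt (fun t : ℝ ↦ a + b * t + c * t ^ 2 + d * t ^ 3)
        (b + 2 * c * t + 3 * d * t ^ 2) t :=
      (((((hasDerivAt_id t).const_mul b).const_add a).fun_add
        ((hasDerivAt_pow 2 t).const_mul c)).fun_add
          ((hasDerivAt_pow 3 t).const_mul d)).congr_deriv (by simp; ring)
    rw [(hp.fun_mul he.exp).deriv, h0, h1, h2, h3]
    linear_combination t ^ 4 * Real.exp (0 * t + v * t ^ 2 / 2) * h4
  have e0 : (fun t : ℝ ↦ Real.exp (0 * t + v * t ^ 2 / 2))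
      = fun t ↦ (1 + 0 * t + 0 * t ^ 2 + 0 * t ^ 3) * Real.exp (0 * t + v * t ^ 2 / 2) := by
    ext t
    ring
  rw [h1, mgf_fun_id_gaussianReal, iteratedDeriv_eq_iterate]
  simp only [Function.iterate_succ, Function.iterate_zero, Function.comp_apply, id_eq]
  rw [e0, hd 1 0 0 0 0 v 0 0 rfl (by ring) (by ring) (by ring) (by ring),
    hd 0 v 0 0 v 0 (v ^ 2) 0 rfl (by ring) (by ring) (by ring) (by ring),
    hd v 0 (v ^ 2) 0 0 (3 * v ^ 2) 0 (v ^ 3) rfl (by ring) (by ring) (by ring) (by ring)]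
  have he : HasDerivAt (fun t : ℝ ↦ 0 * t + (v : ℝ) * t ^ 2 / 2) 0 0 :=
    (((hasDerivAt_id (0 : ℝ)).const_mul 0).fun_add
      (((hasDerivAt_pow 2 (0 : ℝ)).const_mul (v : ℝ)).div_const 2)).congr_deriv (by simp)
  have hp : HasDerivAt (fun t : ℝ ↦ 0 + 3 * (v : ℝ) ^ 2 * t + 0 * t ^ 2 + v ^ 3 * t ^ 3)
      (3 * (v : ℝ) ^ 2) 0 :=
    (((((hasDerivAt_id (0 : ℝ)).const_mul (3 * (v : ℝ) ^ 2)).const_add 0).fun_add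
      ((hasDerivAt_pow 2 (0 : ℝ)).const_mul 0)).fun_add
        ((hasDerivAt_pow 3 (0 : ℝ)).const_mul ((v : ℝ) ^ 3))).congr_deriv (by simp)
  rw [(hp.fun_mul he.exp).deriv]
  simp

variable {Ω : Type*} {mΩ : MeasurableSpace Ω} {μ : Measure Ω}

theorem hasLaw_gaussianReal_linearCombination {ξ : ℕ → Ω → ℝ} (hind : iIndepFun ξ μ)
    (hξ : ∀ k, HasLaw (ξ k) (gaussianReal 0 1) μ) (a : ℕ → ℝ) (s : Finset ℕ) :
    HasLaw (fun ω ↦ ∑ k ∈ s, a k * ξ k ω) (gaussianReal 0 (∑ k ∈ s, a k ^ 2).toNNReal) μ := by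
  have hlaw (k : ℕ) : HasLaw (fun ω ↦ a k * ξ k ω) (gaussianReal 0 ((a k ^ 2).toNNReal)) μ := by
    have := gaussianReal_const_mul (hξ k) (a k)
    rw [mul_zero, mul_one] at this
    convert this using 2
    ext
    simp [sq_nonneg]
  have := hind.isProbabilityMeasure
  have hind' : iIndepFun (fun k ω ↦ a k * ξ k ω) μ :=
    hind.comp (fun k x ↦ a k * x) (fun k ↦ by fun_prop)
  induction s using Finset.induction_on with
  | empty =>
    simp only [Finset.sum_empty, Real.toNNReal_zero, gaussianReal_zero_var]
    exact ⟨aemeasurable_const, by simp⟩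
  | insert i s hi ih =>
    have hadd : IndepFun (fun ω ↦ ∑ k ∈ s, a k * ξ k ω) (fun ω ↦ a i * ξ i ω) μ := by
      have := hind'.indepFun_finsetSum_of_notMem₀ (fun k ↦ (hlaw k).aemeasurable) hi
      convert this using 1
      ext ω
      simp
    refine ⟨?_, ?_⟩
    · exact Finset.aemeasurable_fun_sum _ fun k _ ↦ (hlaw k).aemeasurable
    · have := gaussianReal_add_gaussianReal_of_indepFun hadd ih.map_eq (hlaw i).map_eq
      rw [zero_add, ← Real.toNNReal_add (Finset.sum_nonneg fun k _ ↦ sq_nonneg _)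
        (sq_nonneg _)] at this
      rw [Finset.sum_insert hi, add_comm, ← this]
      congr 1
      ext ω
      simp [Finset.sum_insert hi, add_comm]

/-- The block sums are independent centred normals, degenerate for an empty block. Their fourth
moments 3 v_j² give Var(X_j²) = 2 v_j², and the second moment about c is variance plus squared bias.
-/
theorem lintegral_sq_sum_sq_sub {ξ : ℕ → Ω → ℝ} (hind : iIndepFun ξ μ)
    (hξ : ∀ k, HasLaw (ξ k) (gaussianReal 0 1) μ) (a : ℕ → ℝ) (c : ℝ) {M : ℕ}
    (s : Fin M → Finset ℕ) (hs : Pairwise fun i j ↦ Disjoint (s i) (s j)) :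
    ∫⁻ ω, ENNReal.ofReal ((∑ j, (∑ k ∈ s j, a k * ξ k ω) ^ 2 - c) ^ 2) ∂μ
      = ENNReal.ofReal ((∑ j, ∑ k ∈ s j, a k ^ 2 - c) ^ 2
          + 2 * ∑ j, (∑ k ∈ s j, a k ^ 2) ^ 2) := by
  have := hind.isProbabilityMeasure
  set X : Fin M → Ω → ℝ := fun j ω ↦ ∑ k ∈ s j, a k * ξ k ω
  set v : Fin M → ℝ := fun j ↦ ∑ k ∈ s j, a k ^ 2
  have hv (j) : 0 ≤ v j := Finset.sum_nonneg fun k _ ↦ sq_nonneg _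
  have hX (j) : HasLaw (X j) (gaussianReal 0 (v j).toNNReal) μ :=
    hasLaw_gaussianReal_linearCombination hind hξ a (s j)
  have hXp (j) (p : ℝ≥0∞) (hp : p ≠ ∞) : MemLp (X j) p μ := by
    have := memLp_id_gaussianReal' (μ := 0) (v := (v j).toNNReal) p hp
    rw [← (hX j).map_eq] at this
    exact this.comp_of_map (hX j).aemeasurable
  have h2 (j) : ∫ ω, X j ω ^ 2 ∂μ = v j := by
    have h : Var[X j; μ] = v j := by
      rw [(hX j).variance_eq, variance_id_gaussianReal, Real.coe_toNNReal _ (hv j)]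
    have h0 : ∫ ω, X j ω ∂μ = 0 := by
      rw [(hX j).integral_eq, integral_id_gaussianReal]
    rw [variance_of_integral_eq_zero (hX j).aemeasurable h0] at h
    exact h
  have h4 (j) : ∫ ω, X j ω ^ 4 ∂μ = 3 * v j ^ 2 := by
    rw [← Real.coe_toNNReal _ (hv j), ← integral_pow_four_gaussianReal, ← (hX j).map_eq,
      integral_map (hX j).aemeasurable (by fun_prop)]
  have hL2 (j) : MemLp (fun ω ↦ X j ω ^ 2) 2 μ := by
    rw [memLp_two_iff_integrable_sq ((hX j).aemeasurable.pow_const 2).aestronglyMeasurable]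
    have := (hXp j 4 (by simp)).integrable_norm_pow (by norm_num)
    refine this.congr (ae_of_all _ fun ω ↦ ?_)
    simp only [Real.norm_eq_abs]
    rw [← pow_mul]
    exact Even.pow_abs (by decide) _
  have hvar (j) : Var[fun ω ↦ X j ω ^ 2; μ] = 2 * v j ^ 2 := by
    rw [variance_eq_sub (hL2 j)]
    have : ((fun ω ↦ X j ω ^ 2) ^ 2 : Ω → ℝ) = fun ω ↦ X j ω ^ 4 := by
      ext ω
      simp [← pow_mul]
    rw [this, h2, h4]
    ring
  have hindep : (univ : Set (Fin M)).Pairwise fun i j ↦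
      IndepFun (fun ω ↦ X i ω ^ 2) (fun ω ↦ X j ω ^ 2) μ := by
    intro i _ j _ hij
    have := hind.indepFun_finset₀ (s i) (s j) (hs hij) fun k ↦ (hξ k).aemeasurable
    have := this.comp (φ := fun x : s i → ℝ ↦ (∑ k : s i, a k * x k) ^ 2)
      (ψ := fun x : s j → ℝ ↦ (∑ k : s j, a k * x k) ^ 2) (by fun_prop) (by fun_prop)
    convert this using 1
    all_goals
      ext ω
      simp only [X, Function.comp]
      rw [← Finset.sum_coe_sort]
  have hW : MemLp (fun ω ↦ ∑ j, X j ω ^ 2) 2 μ := memLp_finsetSum _ fun j _ ↦ hL2 j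
  have hEW : ∫ ω, ∑ j, X j ω ^ 2 ∂μ = ∑ j, v j := by
    rw [integral_finsetSum _ fun j _ ↦ (hL2 j).integrable (by norm_num)]
    exact Finset.sum_congr rfl fun j _ ↦ h2 j
  have hVW : Var[fun ω ↦ ∑ j, X j ω ^ 2; μ] = ∑ j, 2 * v j ^ 2 := by
    have := IndepFun.variance_sum (s := Finset.univ) (fun j _ ↦ hL2 j) (by simpa using hindep)
    rw [← Finset.sum_congr rfl fun j _ ↦ hvar j, ← this]
    congr 1
    ext ω
    simp
  rw [← ofReal_integral_eq_lintegral_ofReal]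
  · congr 1
    have hsub : MemLp (fun ω ↦ ∑ j, X j ω ^ 2 - c) 2 μ := hW.sub (memLp_const c)
    have h := variance_eq_sub hsub
    rw [variance_sub_const hW.aestronglyMeasurable, hVW,
      integral_sub (hW.integrable (by norm_num)) (integrable_const c), hEW] at h
    simp only [integral_const, probReal_univ, one_smul, Pi.pow_apply] at h
    rw [Finset.mul_sum]
    linarith
  · exact (hW.sub (memLp_const c)).integrable_sq
  · exact ae_of_all _ fun ω ↦ sq_nonneg _


/-! ### Paths of counting processes -/

section Paths

variable {Ω : Type*} {N : ℝ≥0 → Ω → ℕ}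

/-- The infimum is attained, because a right-continuous integer-valued path is constant just to the
right of each time. `hu` ensures that level i is reached; otherwise the infimum is over the empty
set and equals 0. -/
theorem IsCountingProcess.le_iff_arrivalTime_le (hN : IsCountingProcess N) {i : ℕ} {ω : Ω}
    {u : ℝ≥0} (hu : i ≤ N u ω) (t : ℝ≥0) : i ≤ N t ω ↔ arrivalTime N i ω ≤ t := by
  refine ⟨fun h ↦ csInf_le (OrderBot.bddBelow _) h, fun h ↦ ?_⟩
  have hne : {t | i ≤ N t ω}.Nonempty := ⟨u, hu⟩
  suffices i ≤ N (arrivalTime N i ω) ω from this.trans (hN.mono ω h)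
  have hev : ∀ᶠ s in 𝓝[≥] (arrivalTime N i ω), N s ω = N (arrivalTime N i ω) ω := by
    have := hN.rightCont ω (arrivalTime N i ω)
    rw [ContinuousWithinAt, nhds_discrete, tendsto_pure] at this
    exact this
  obtain ⟨v, hv, hv'⟩ := (mem_nhdsGE_iff_exists_Ico_subset' (lt_add_one _)).1 hev
  obtain ⟨s, hs, hsv⟩ := exists_lt_of_csInf_lt hne hv
  rw [← hv' ⟨csInf_le (OrderBot.bddBelow _) hs, hsv⟩]
  exact hs

/-- Unit jumps exclude overshooting: some earlier time has a value below i, and the path rises from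
there by at most one. -/
theorem IsCountingProcess.apply_arrivalTime (hN : IsCountingProcess N) {i : ℕ} {ω : Ω}
    {u : ℝ≥0} (hu : i ≤ N u ω) : N (arrivalTime N i ω) ω = i := by
  have hle : i ≤ N (arrivalTime N i ω) ω := (hN.le_iff_arrivalTime_le hu _).2 le_rfl
  refine le_antisymm ?_ hle
  rcases eq_zero_or_pos (arrivalTime N i ω) with h0 | hpos
  · rw [h0, hN.zero]
    exact Nat.zero_le _
  · obtain ⟨s, hs, hs'⟩ := hN.unitJumps ω _ hpos
    have : ¬ i ≤ N s ω := fun h ↦ hs.not_ge ((hN.le_iff_arrivalTime_le hu s).1 h)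
    omega

theorem IsCountingProcess.arrivalTime_le (hN : IsCountingProcess N) {i : ℕ} {ω : Ω}
    {t : ℝ≥0} (ht : i ≤ N t ω) : arrivalTime N i ω ≤ t :=
  (hN.le_iff_arrivalTime_le ht t).1 ht

theorem IsCountingProcess.tickIncrement_eq (hN : IsCountingProcess N) (B : ℝ≥0 → Ω → ℝ)
    {k : ℕ} {ω : Ω} {u : ℝ≥0} (hu : k + 1 ≤ N u ω) :
    tickIncrement B N (k + 1) ω = B (k + 1 : ℕ) ω - B k ω := by
  rw [tickIncrement, hN.apply_arrivalTime hu, Nat.add_sub_cancel,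
    hN.apply_arrivalTime (k.le_succ.trans hu)]

theorem jumpIntegral_eq_sum_Ico {E : Type*} [AddCommMonoid E] (N : ℝ≥0 → Ω → ℕ)
    (f : ℝ≥0 → Ω → E) (s t : ℝ≥0) (ω : Ω) :
    jumpIntegral N f s t ω
      = ∑ k ∈ Finset.Ico (N s ω) (N t ω), f (arrivalTime N (k + 1) ω) ω := by
  rw [Finset.sum_Ico_add' (fun i ↦ f (arrivalTime N i ω) ω) (N s ω) (N t ω) 1, jumpIntegral]
  congr 1
  ext i
  simp only [Finset.mem_Ioc, Finset.mem_Ico]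
  omega

theorem IsCountingProcess.timeChangedIntegral_sub (hN : IsCountingProcess N)
    (B sig : ℝ≥0 → Ω → ℝ) {s t : ℝ≥0} (hst : s ≤ t) (ω : Ω) :
    timeChangedIntegral B N sig 0 t ω - timeChangedIntegral B N sig 0 s ω
      = ∑ k ∈ Finset.Ico (N s ω) (N t ω),
          sig (arrivalTime N (k + 1) ω) ω * (B (k + 1 : ℕ) ω - B k ω) := by
  have h (u : ℝ≥0) : timeChangedIntegral B N sig 0 u ω
      = ∑ k ∈ Finset.range (N u ω),
          sig (arrivalTime N (k + 1) ω) ω * (B (k + 1 : ℕ) ω - B k ω) := by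
    -- At the arrival r = t_i one has N(r) = i ≥ 1, so this integrand reproduces ς(t_i) U_i and the
    -- reindexing for `jumpIntegral` applies.
    have := jumpIntegral_eq_sum_Ico N
      (fun r ω ↦ sig r ω * (B (N r ω : ℝ≥0) ω - B (N r ω - 1 : ℕ) ω)) 0 u ω
    rw [hN.zero, Nat.Ico_zero_eq_range] at this
    rw [timeChangedIntegral]
    rw [jumpIntegral] at this
    refine (Finset.sum_congr rfl fun i hi ↦ ?_).trans (this.trans
      (Finset.sum_congr rfl fun k hk ↦ ?_))
    · rw [Finset.mem_Ioc, hN.zero] at hi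
      obtain ⟨k, rfl⟩ : ∃ k, i = k + 1 := ⟨i - 1, by omega⟩
      rw [hN.tickIncrement_eq B hi.2, hN.apply_arrivalTime hi.2, Nat.add_sub_cancel]
    · rw [hN.apply_arrivalTime (Finset.mem_range.1 hk)]
      rfl
  rw [h, h, Finset.sum_Ico_eq_sub _ (hN.mono ω hst)]

/-- The `i`-th arrival time of a process observed on `[0, T]`, set to `T` if there is no such
arrival. -/
noncomputable def cappedArrivalTime (N : ℝ≥0 → Ω → ℕ) (T : ℝ≥0) (i : ℕ) (ω : Ω) : ℝ≥0 :=
  if i ≤ N T ω then arrivalTime N i ω else T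

theorem cappedArrivalTime_of_le {T : ℝ≥0} {i : ℕ} {ω : Ω} (h : i ≤ N T ω) :
    cappedArrivalTime N T i ω = arrivalTime N i ω :=
  if_pos h

theorem IsCountingProcess.cappedArrivalTime_le (hN : IsCountingProcess N) (T : ℝ≥0) (i : ℕ)
    (ω : Ω) : cappedArrivalTime N T i ω ≤ T := by
  rw [cappedArrivalTime]
  split_ifs with h
  · exact hN.arrivalTime_le h
  · exact le_rfl

end Paths

/-! ### Joint measurability of processes observed on `[0, T]` -/

section JointMeasurability

variable {Ω : Type*} {mΩ : MeasurableSpace Ω}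

/-- Discretized time takes countably many values, so each approximation is jointly measurable, and
so is the limit. Staying below T keeps the result measurable for σ-algebras that observe the process
only on [0, T]. -/
theorem measurable_uncurry_min_of_tendsto {E : Type*} [TopologicalSpace E]
    [TopologicalSpace.PseudoMetrizableSpace E] [MeasurableSpace E] [BorelSpace E]
    {X : ℝ≥0 → Ω → E} {T : ℝ≥0} (hX : ∀ t ≤ T, Measurable (X t)) {g : ℕ → ℝ≥0 → ℝ≥0}
    (hgT : ∀ n t, g n t ≤ T) (hgm : ∀ n, Measurable (g n)) (hgc : ∀ n, (range (g n)).Countable)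
    (hlim : ∀ t ω, Tendsto (fun n ↦ X (g n t) ω) atTop (𝓝 (X (min t T) ω))) :
    Measurable fun p : ℝ≥0 × Ω ↦ X (min p.1 T) p.2 := by
  refine measurable_of_tendsto_metrizable (f := fun n p ↦ X (g n p.1) p.2) (fun n ↦ ?_)
    (tendsto_pi_nhds.2 fun p ↦ hlim p.1 p.2)
  intro S hS
  have : (fun p : ℝ≥0 × Ω ↦ X (g n p.1) p.2) ⁻¹' S
      = ⋃ q ∈ range (g n), (g n ⁻¹' {q}) ×ˢ (X q ⁻¹' S) := by
    ext p
    simp only [mem_preimage, mem_iUnion, mem_prod, mem_singleton_iff, exists_prop,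
      mem_range]
    exact ⟨fun h ↦ ⟨g n p.1, ⟨p.1, rfl⟩, rfl, h⟩, fun ⟨q, _, hq, h⟩ ↦ hq ▸ h⟩
  rw [this]
  refine MeasurableSet.biUnion (hgc n) ?_
  rintro _ ⟨t, rfl⟩
  exact (hgm n (measurableSet_singleton _)).prod (hX _ (hgT n t) hS)

theorem measurable_uncurry_min_of_leftCont {X : ℝ≥0 → Ω → ℝ} {T : ℝ≥0}
    (hX : ∀ t ≤ T, Measurable (X t))
    (hc : ∀ ω t, ContinuousWithinAt (fun s ↦ X s ω) (Iic t) t) :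
    Measurable fun p : ℝ≥0 × Ω ↦ X (min p.1 T) p.2 := by
  have hle (n : ℕ) (t : ℝ≥0) : (⌊((n : ℝ≥0) + 1) * t⌋₊ : ℝ≥0) / (n + 1) ≤ t := by
    rw [div_le_iff₀ (by positivity), mul_comm t]
    exact Nat.floor_le zero_le
  refine measurable_uncurry_min_of_tendsto hX
    (g := fun n t ↦ (⌊((n : ℝ≥0) + 1) * min t T⌋₊ : ℝ≥0) / (n + 1))
    (fun n t ↦ (hle n _).trans (min_le_right _ _)) (fun n ↦ ?_) (fun n ↦ ?_) fun t ω ↦ ?_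
  · have : Measurable fun t : ℝ≥0 ↦ ⌊((n : ℝ≥0) + 1) * min t T⌋₊ :=
      Nat.measurable_floor.comp (by fun_prop)
    exact ((measurable_from_nat (f := fun k : ℕ ↦ (k : ℝ≥0))).comp this).div_const _
  · refine (countable_range fun k : ℕ ↦ (k : ℝ≥0) / (n + 1)).mono ?_
    rintro _ ⟨t, rfl⟩
    exact ⟨_, rfl⟩
  · refine (hc ω (min t T)).tendsto.comp (tendsto_nhdsWithin_iff.2
      ⟨?_, Eventually.of_forall fun n ↦ hle n _⟩)
    rw [← NNReal.tendsto_coe]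
    refine tendsto_of_tendsto_of_tendsto_of_le_of_le
      (g := fun n : ℕ ↦ ((min t T : ℝ≥0) : ℝ) - 1 / (n + 1)) (h := fun _ ↦ ((min t T : ℝ≥0) : ℝ))
      ?_ tendsto_const_nhds (fun n ↦ ?_) fun n ↦ NNReal.coe_le_coe.2 (hle n _)
    · simpa using tendsto_const_nhds.sub (tendsto_one_div_add_atTop_nhds_zero_nat (𝕜 := ℝ))
    · have h := Nat.lt_floor_add_one (((n : ℝ≥0) + 1) * min t T)
      have h' : ((n : ℝ) + 1) * (min t T : ℝ≥0) < ⌊((n : ℝ≥0) + 1) * min t T⌋₊ + 1 := by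
        exact_mod_cast h
      have hn : (0 : ℝ) < n + 1 := by positivity
      change ((min t T : ℝ≥0) : ℝ) - 1 / (n + 1)
        ≤ ((⌊((n : ℝ≥0) + 1) * min t T⌋₊ : ℝ≥0) / (n + 1) : ℝ≥0)
      push_cast at h' ⊢
      rw [sub_le_iff_le_add, ← add_div, le_div_iff₀ hn]
      linarith

theorem measurable_uncurry_min_of_rightCont {X : ℝ≥0 → Ω → ℕ} {T : ℝ≥0}
    (hX : ∀ t ≤ T, Measurable (X t))
    (hc : ∀ ω t, ContinuousWithinAt (fun s ↦ X s ω) (Ici t) t) :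
    Measurable fun p : ℝ≥0 × Ω ↦ X (min p.1 T) p.2 := by
  have hge (n : ℕ) (t : ℝ≥0) : t ≤ (⌈((n : ℝ≥0) + 1) * t⌉₊ : ℝ≥0) / (n + 1) := by
    rw [le_div_iff₀ (by positivity), mul_comm t]
    exact Nat.le_ceil _
  refine measurable_uncurry_min_of_tendsto hX
    -- Right-continuity requires approximation from above; the outer minimum keeps the grid times
    -- from passing T.
    (g := fun n t ↦ min ((⌈((n : ℝ≥0) + 1) * min t T⌉₊ : ℝ≥0) / (n + 1)) T)
    (fun n t ↦ min_le_right _ _) (fun n ↦ ?_) (fun n ↦ ?_) fun t ω ↦ ?_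
  · have : Measurable fun t : ℝ≥0 ↦ ⌈((n : ℝ≥0) + 1) * min t T⌉₊ :=
      Nat.measurable_ceil.comp (by fun_prop)
    exact (((measurable_from_nat (f := fun k : ℕ ↦ (k : ℝ≥0))).comp this).div_const _).min
      measurable_const
  · refine (countable_range fun k : ℕ ↦ min ((k : ℝ≥0) / (n + 1)) T).mono ?_
    rintro _ ⟨t, rfl⟩
    exact ⟨_, rfl⟩
  · have hge' (n : ℕ) : min t T
        ≤ min ((⌈((n : ℝ≥0) + 1) * min t T⌉₊ : ℝ≥0) / (n + 1)) T :=
      le_min (hge n _) (min_le_right _ _)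
    refine (hc ω (min t T)).tendsto.comp (tendsto_nhdsWithin_iff.2
      ⟨?_, Eventually.of_forall hge'⟩)
    rw [← NNReal.tendsto_coe]
    refine tendsto_of_tendsto_of_tendsto_of_le_of_le
      (g := fun _ ↦ ((min t T : ℝ≥0) : ℝ)) (h := fun n : ℕ ↦ ((min t T : ℝ≥0) : ℝ) + 1 / (n + 1))
      tendsto_const_nhds ?_ (fun n ↦ NNReal.coe_le_coe.2 (hge' n)) fun n ↦ ?_
    · simpa using tendsto_const_nhds.add (tendsto_one_div_add_atTop_nhds_zero_nat (𝕜 := ℝ))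
    · have h := Nat.ceil_lt_add_one (a := ((n : ℝ≥0) + 1) * min t T) zero_le
      have h' : (⌈((n : ℝ≥0) + 1) * min t T⌉₊ : ℝ) < ((n : ℝ) + 1) * (min t T : ℝ≥0) + 1 := by
        exact_mod_cast h
      have hn : (0 : ℝ) < n + 1 := by positivity
      refine (NNReal.coe_le_coe.2 (min_le_left _ _)).trans ?_
      have he : (((min t T : ℝ≥0) : ℝ) + 1 / (n + 1)) * (n + 1)
          = ((n : ℝ) + 1) * (min t T : ℝ≥0) + 1 := by
        field_simp
      have : (⌈((n : ℝ≥0) + 1) * min t T⌉₊ : ℝ) / (n + 1)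
          ≤ ((min t T : ℝ≥0) : ℝ) + 1 / (n + 1) := by
        rw [div_le_iff₀ hn, he]
        exact h'.le
      exact_mod_cast this

/-- For t < T, an arrival by time t is the event i ≤ N(t). The cap makes the events with t ≥ T
trivial, so only N on [0, T] is consulted. -/
theorem measurable_cappedArrivalTime {N : ℝ≥0 → Ω → ℕ} (hN : IsCountingProcess N) {T : ℝ≥0}
    (hm : ∀ t ≤ T, Measurable (N t)) (i : ℕ) : Measurable (cappedArrivalTime N T i) := by
  refine measurable_of_Iic fun t ↦ ?_
  rcases lt_or_ge t T with h | h
  · have : cappedArrivalTime N T i ⁻¹' Iic t = N t ⁻¹' Ici i := by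
      ext ω
      simp only [mem_preimage, mem_Iic, mem_Ici, cappedArrivalTime]
      split_ifs with hi
      · exact (hN.le_iff_arrivalTime_le hi t).symm
      · exact ⟨fun h' ↦ absurd h' h.not_ge, fun h' ↦ absurd (h'.trans (hN.mono ω h.le)) hi⟩
    rw [this]
    exact hm t h.le measurableSet_Ici
  · have : cappedArrivalTime N T i ⁻¹' Iic t = univ :=
      eq_univ_of_forall fun ω ↦ (hN.cappedArrivalTime_le T i ω).trans h
    rw [this]
    exact MeasurableSet.univ

theorem measurable_intervalIntegral_of_le {f : ℝ≥0 → Ω → ℝ} {T : ℝ≥0}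
    (hf : Measurable fun p : ℝ≥0 × Ω ↦ f (min p.1 T) p.2) {a b : Ω → ℝ≥0} (ha : Measurable a)
    (hb : Measurable b) (hab : ∀ ω, a ω ≤ b ω) (hbT : ∀ ω, b ω ≤ T) :
    Measurable fun ω ↦ ∫ r in (a ω : ℝ)..b ω, f r.toNNReal ω := by
  have h : Measurable fun p : Ω × ℝ ↦
      {p : Ω × ℝ | (a p.1 : ℝ) < p.2 ∧ p.2 ≤ b p.1}.indicator
        (fun p : Ω × ℝ ↦ f (min p.2.toNNReal T) p.1) p := by
    have hp : Measurable fun p : Ω × ℝ ↦ (p.2.toNNReal, p.1) := by fun_prop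
    have h1 : MeasurableSet {p : Ω × ℝ | (a p.1 : ℝ) < p.2} :=
      measurableSet_lt (by fun_prop) (by fun_prop)
    have h2 : MeasurableSet {p : Ω × ℝ | p.2 ≤ b p.1} :=
      measurableSet_le (by fun_prop) (by fun_prop)
    exact (hf.comp hp).indicator (h1.inter h2)
  have h' := (h.stronglyMeasurable.integral_prod_right' (ν := volume)).measurable
  convert h' using 1
  ext ω
  rw [intervalIntegral.integral_of_le (NNReal.coe_le_coe.2 (hab ω)),
    ← integral_indicator measurableSet_Ioc]
  congr 1
  ext r
  by_cases hr : r ∈ Ioc (a ω : ℝ) (b ω)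
  · have hrT : min r.toNNReal T = r.toNNReal :=
      min_eq_left (Real.toNNReal_le_iff_le_coe.2 (hr.2.trans (hbT ω)))
    rw [indicator_of_mem hr, indicator_of_mem (by exact hr)]
    simp only [hrT]
  · rw [indicator_of_notMem hr, indicator_of_notMem (by exact hr)]

theorem measurable_IV {lam sig : ℝ≥0 → Ω → ℝ} {T : ℝ≥0}
    (hlam : Measurable fun p : ℝ≥0 × Ω ↦ lam (min p.1 T) p.2)
    (hsig : Measurable fun p : ℝ≥0 × Ω ↦ sig (min p.1 T) p.2) {a b : Ω → ℝ≥0}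
    (ha : Measurable a) (hb : Measurable b) (hab : ∀ ω, a ω ≤ b ω) (hbT : ∀ ω, b ω ≤ T) :
    Measurable fun ω ↦ IV lam sig (a ω) (b ω) ω :=
  measurable_intervalIntegral_of_le (f := fun r ω ↦ sig r ω ^ 2 * lam r ω)
    ((hsig.pow_const 2).mul hlam) ha hb hab hbT

theorem measurable_IQ {lam sig : ℝ≥0 → Ω → ℝ} {T : ℝ≥0}
    (hlam : Measurable fun p : ℝ≥0 × Ω ↦ lam (min p.1 T) p.2)
    (hsig : Measurable fun p : ℝ≥0 × Ω ↦ sig (min p.1 T) p.2) {a b : Ω → ℝ≥0}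
    (ha : Measurable a) (hb : Measurable b) (hab : ∀ ω, a ω ≤ b ω) (hbT : ∀ ω, b ω ≤ T) :
    Measurable fun ω ↦ IQ lam sig (a ω) (b ω) ω :=
  measurable_intervalIntegral_of_le (f := fun r ω ↦ sig r ω ^ 4 * lam r ω)
    ((hsig.pow_const 4).mul hlam) ha hb hab hbT

end JointMeasurability


/-! ### The squared error given the realized information -/

section Blocks

variable {M : ℕ} {n : Fin (M + 1) → ℕ}

theorem pairwise_disjoint_Ico_succ (hn : Monotone n) :
    Pairwise fun i j : Fin M ↦
      Disjoint (Finset.Ico (n i.castSucc) (n i.succ)) (Finset.Ico (n j.castSucc) (n j.succ)) := by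
  have key (i j : Fin M) (h : i < j) :
      Disjoint (Finset.Ico (n i.castSucc) (n i.succ)) (Finset.Ico (n j.castSucc) (n j.succ)) := by
    rw [Finset.disjoint_left]
    intro k hk hk'
    rw [Finset.mem_Ico] at hk hk'
    have : n i.succ ≤ n j.castSucc := hn (Fin.le_castSucc_iff.2 (Fin.succ_lt_succ_iff.2 h))
    omega
  intro i j hij
  rcases lt_or_gt_of_ne hij with h | h
  · exact key i j h
  · exact (key j i h).symm

theorem sum_succ_sub_castSucc {E : Type*} [AddCommGroup E] (f : Fin (M + 1) → E) :
    ∑ j : Fin M, (f j.succ - f j.castSucc) = f (Fin.last M) - f 0 := by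
  rw [Finset.sum_sub_distrib]
  have h := (Fin.sum_univ_succ f).symm.trans (Fin.sum_univ_castSucc f)
  rw [sub_eq_sub_iff_add_eq_add, add_comm, h, add_comm]

theorem sum_sum_Ico_succ {E : Type*} [AddCommGroup E] (hn : Monotone n) (f : ℕ → E) :
    ∑ j : Fin M, ∑ k ∈ Finset.Ico (n j.castSucc) (n j.succ), f k
      = ∑ k ∈ Finset.Ico (n 0) (n (Fin.last M)), f k := by
  rw [Finset.sum_Ico_eq_sub _ (hn (Fin.zero_le _)),
    Finset.sum_congr rfl fun j _ ↦ Finset.sum_Ico_eq_sub f (hn (Fin.castSucc_lt_succ (i := j)).le),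
    sum_succ_sub_castSucc fun j ↦ ∑ k ∈ Finset.range (n j), f k]

end Blocks

theorem measurable_sum_Ico :
    Measurable fun p : ℕ × ℕ × (ℕ → ℝ) ↦ ∑ k ∈ Finset.Ico p.1 p.2.1, p.2.2 k := by
  refine measurable_from_prod_countable_right fun i ↦ measurable_from_prod_countable_right fun j ↦ ?_
  simp only
  fun_prop

theorem measurable_rIV {Ω : Type*} {mΩ : MeasurableSpace Ω} {N : ℝ≥0 → Ω → ℕ} {sig : ℝ≥0 → Ω → ℝ}
    {T : ℝ≥0} (hN : IsCountingProcess N) (hNm : ∀ t ≤ T, Measurable (N t))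
    (hsig : Measurable fun p : ℝ≥0 × Ω ↦ sig (min p.1 T) p.2) {a b : Ω → ℝ≥0}
    (ha : Measurable a) (hb : Measurable b) (haT : ∀ ω, a ω ≤ T) (hbT : ∀ ω, b ω ≤ T) :
    Measurable fun ω ↦ rIV N sig (a ω) (b ω) ω := by
  have hNt {c : Ω → ℝ≥0} (hc : Measurable c) (hcT : ∀ ω, c ω ≤ T) :
      Measurable fun ω ↦ N (c ω) ω := by
    have := (measurable_uncurry_min_of_rightCont hNm hN.rightCont).comp (hc.prodMk measurable_id)
    convert this using 1
    ext ω
    simp [min_eq_left (hcT ω)]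
  have hf : Measurable fun ω (k : ℕ) ↦ sig (cappedArrivalTime N T (k + 1) ω) ω ^ 2 := by
    refine measurable_pi_lambda _ fun k ↦ Measurable.pow_const ?_ 2
    have := hsig.comp ((measurable_cappedArrivalTime hN hNm (k + 1)).prodMk measurable_id)
    convert this using 1
    ext ω
    simp [min_eq_left (hN.cappedArrivalTime_le T (k + 1) ω)]
  have := measurable_sum_Ico.comp ((hNt ha haT).prodMk ((hNt hb hbT).prodMk hf))
  convert this using 1
  ext ω
  rw [rIV, jumpIntegral_eq_sum_Ico]
  refine Finset.sum_congr rfl fun k hk ↦ ?_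
  have hk' : k + 1 ≤ N T ω := (Finset.mem_Ico.1 hk).2.trans_le (hN.mono ω (hbT ω))
  simp only [cappedArrivalTime_of_le hk']

/-- By independence the joint law of the m-measurable data and the Gaussian sequence is a product.
Fubini integrates the sequence first with the data frozen, which reduces the claim to
`lintegral_sq_sum_sq_sub`. -/
theorem setLIntegral_sq_sum_sq_sub_of_indep {Ω : Type*} {m mΩ : MeasurableSpace Ω}
    {μ : Measure Ω} {ξ : ℕ → Ω → ℝ} (hind : iIndepFun ξ μ)
    (hξ : ∀ k, HasLaw (ξ k) (gaussianReal 0 1) μ) (hξm : ∀ k, Measurable (ξ k))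
    (hm : m ≤ mΩ)
    (hmξ : Indep m (MeasurableSpace.comap (fun ω k ↦ ξ k ω) inferInstance) μ)
    {a : ℕ → Ω → ℝ} (ha : ∀ k, Measurable[m] (a k)) {M : ℕ} {n : Fin (M + 1) → Ω → ℕ}
    (hn : ∀ j, Measurable[m] (n j)) (hmono : ∀ ω, Monotone fun j ↦ n j ω)
    {c : Ω → ℝ} (hc : Measurable[m] c) {S : Set Ω} (hS : MeasurableSet[m] S) :
    ∫⁻ ω in S, ENNReal.ofReal ((∑ j : Fin M,
        (∑ k ∈ Finset.Ico (n j.castSucc ω) (n j.succ ω), a k ω * ξ k ω) ^ 2 - c ω) ^ 2) ∂μ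
      = ∫⁻ ω in S, ENNReal.ofReal
          ((∑ j : Fin M, ∑ k ∈ Finset.Ico (n j.castSucc ω) (n j.succ ω), a k ω ^ 2 - c ω) ^ 2
          + 2 * ∑ j : Fin M,
            (∑ k ∈ Finset.Ico (n j.castSucc ω) (n j.succ ω), a k ω ^ 2) ^ 2) ∂μ := by
  have := hind.isProbabilityMeasure
  -- The indicator of S is part of the frozen data, so the set integral becomes an integral over the
  -- whole product space.
  let D : Ω → (ℕ → ℝ) × (Fin (M + 1) → ℕ) × ℝ × ℝ≥0∞ :=
    fun ω ↦ (fun k ↦ a k ω, fun j ↦ n j ω, c ω, S.indicator 1 ω)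
  have hD : Measurable[m] D :=
    (@measurable_pi_lambda _ _ _ m _ _ ha).prodMk ((@measurable_pi_lambda _ _ _ m _ _ hn).prodMk
      (hc.prodMk (Measurable.indicator measurable_const hS)))
  have hDm : Measurable D := hD.mono hm le_rfl
  let Ξ : Ω → ℕ → ℝ := fun ω k ↦ ξ k ω
  have hΞ : Measurable Ξ := measurable_pi_lambda _ hξm
  have hDΞ : IndepFun D Ξ μ := indep_of_indep_of_le_left hmξ hD.comap_le
  let Φ : ((ℕ → ℝ) × (Fin (M + 1) → ℕ) × ℝ × ℝ≥0∞) × (ℕ → ℝ) → ℝ≥0∞ := fun p ↦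
    p.1.2.2.2 * ENNReal.ofReal ((∑ j : Fin M,
      (∑ k ∈ Finset.Ico (p.1.2.1 j.castSucc) (p.1.2.1 j.succ), p.1.1 k * p.2 k) ^ 2
        - p.1.2.2.1) ^ 2)
  have hΦ : Measurable Φ := by
    have h (j : Fin M) : Measurable fun p : ((ℕ → ℝ) × (Fin (M + 1) → ℕ) × ℝ × ℝ≥0∞) × (ℕ → ℝ) ↦
        ∑ k ∈ Finset.Ico (p.1.2.1 j.castSucc) (p.1.2.1 j.succ), p.1.1 k * p.2 k := by
      have : Measurable fun p : ((ℕ → ℝ) × (Fin (M + 1) → ℕ) × ℝ × ℝ≥0∞) × (ℕ → ℝ) ↦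
          (p.1.2.1 j.castSucc, p.1.2.1 j.succ, fun k ↦ p.1.1 k * p.2 k) := by fun_prop
      exact measurable_sum_Ico.comp this
    fun_prop
  have hlhs (ω : Ω) : S.indicator (fun ω ↦ ENNReal.ofReal ((∑ j : Fin M,
        (∑ k ∈ Finset.Ico (n j.castSucc ω) (n j.succ ω), a k ω * ξ k ω) ^ 2 - c ω) ^ 2)) ω
      = Φ (D ω, Ξ ω) := by
    by_cases hω : ω ∈ S <;> simp [Φ, D, Ξ, hω]
  rw [← lintegral_indicator (hm _ hS), ← lintegral_indicator (hm _ hS), lintegral_congr hlhs,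
    ← lintegral_map hΦ (hDm.prodMk hΞ),
    (indepFun_iff_map_prod_eq_prod_map_map hDm.aemeasurable hΞ.aemeasurable).1 hDΞ,
    lintegral_prod _ hΦ.aemeasurable, lintegral_map hΦ.lintegral_prod_right' hDm]
  refine lintegral_congr fun ω ↦ ?_
  rw [lintegral_map (by fun_prop) hΞ]
  by_cases hω : ω ∈ S
  · have := lintegral_sq_sum_sq_sub hind hξ (fun k ↦ a k ω) (c ω)
      (fun j : Fin M ↦ Finset.Ico (n j.castSucc ω) (n j.succ ω))
      (pairwise_disjoint_Ico_succ (hmono ω))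
    simpa [Φ, D, Ξ, hω] using this
  · simp [Φ, D, hω]

variable {Ω : Type*} {mΩ : MeasurableSpace Ω} {μ : Measure Ω}

/-! ### Measurability of the ingredients of the model -/

section Model

variable {T : ℝ≥0} {B : ℝ≥0 → Ω → ℝ} {N : ℝ≥0 → Ω → ℕ} {lam sig P : ℝ≥0 → Ω → ℝ}

theorem measurable_realizedInfo {t : ℝ≥0} (ht : t ≤ T) :
    Measurable[realizedInfo lam sig N T] (lam t)
      ∧ Measurable[realizedInfo lam sig N T] (sig t)
      ∧ Measurable[realizedInfo lam sig N T] (N t) := by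
  have h : Measurable[realizedInfo lam sig N T] fun ω ↦ (lam t ω, sig t ω, N t ω) :=
    (comap_measurable _).mono (le_iSup₂_of_le t ht le_rfl) le_rfl
  exact ⟨measurable_fst.comp h, (measurable_fst.comp measurable_snd).comp h,
    (measurable_snd.comp measurable_snd).comp h⟩

theorem measurable_latentInfo {t : ℝ≥0} (ht : t ≤ T) :
    Measurable[latentInfo lam sig T] (lam t) ∧ Measurable[latentInfo lam sig T] (sig t) := by
  have h : Measurable[latentInfo lam sig T] fun ω ↦ (lam t ω, sig t ω) :=
    (comap_measurable _).mono (le_iSup₂_of_le t ht le_rfl) le_rfl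
  exact ⟨measurable_fst.comp h, measurable_snd.comp h⟩

theorem latentInfo_le_realizedInfo : latentInfo lam sig T ≤ realizedInfo lam sig N T := by
  refine iSup₂_le fun t ht ↦ Measurable.comap_le ?_
  exact (measurable_realizedInfo ht).1.prodMk (measurable_realizedInfo ht).2.1

theorem realizedInfo_le_comap :
    realizedInfo lam sig N T
      ≤ MeasurableSpace.comap (fun ω t ↦ (lam t ω, sig t ω, N t ω)) inferInstance := by
  refine iSup₂_le fun t _ ↦ Measurable.comap_le ?_
  exact (measurable_pi_apply (X := fun _ : ℝ≥0 ↦ ℝ × ℝ × ℕ) t).comp (comap_measurable _)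

theorem latentInfo_le_comap : latentInfo lam sig T
    ≤ MeasurableSpace.comap (fun ω ↦ (fun t ↦ lam t ω, fun t ↦ sig t ω)) inferInstance := by
  have h := comap_measurable
    (m := (inferInstance : MeasurableSpace ((ℝ≥0 → ℝ) × (ℝ≥0 → ℝ))))
    (fun ω ↦ ((fun t ↦ lam t ω, fun t ↦ sig t ω) : (ℝ≥0 → ℝ) × (ℝ≥0 → ℝ)))
  refine iSup₂_le fun t _ ↦ Measurable.comap_le ?_
  exact ((measurable_pi_apply (X := fun _ : ℝ≥0 ↦ ℝ) t).comp (measurable_fst.comp h)).prodMk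
    ((measurable_pi_apply (X := fun _ : ℝ≥0 ↦ ℝ) t).comp (measurable_snd.comp h))

theorem realizedInfo_le (hl : ∀ t, Measurable (lam t)) (hs : ∀ t, Measurable (sig t))
    (hN : ∀ t, Measurable (N t)) : realizedInfo lam sig N T ≤ mΩ :=
  iSup₂_le fun t _ ↦ ((hl t).prodMk ((hs t).prodMk (hN t))).comap_le

theorem IsSamplingGrid.le {M : ℕ} {τ : Fin (M + 1) → Ω → ℝ≥0} (hτ : IsSamplingGrid T τ)
    (j : Fin (M + 1)) (ω : Ω) : τ j ω ≤ T :=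
  (hτ.mono ω (Fin.le_last j)).trans_eq (hτ.last ω)

theorem isBrownianReal_unit_increments (hB : IsBrownianReal B μ) :
    iIndepFun (fun (k : ℕ) ω ↦ B (k + 1 : ℕ) ω - B k ω) μ
      ∧ ∀ k : ℕ, HasLaw (fun ω ↦ B (k + 1 : ℕ) ω - B k ω) (gaussianReal 0 1) μ := by
  refine ⟨hB.hasIndepIncrements.nat (t := fun k : ℕ ↦ (k : ℝ≥0)) Nat.mono_cast, fun k ↦ ?_⟩
  have h := hB.hasLaw_sub (k + 1 : ℕ) k
  have h1 : nndist ((k + 1 : ℕ) : ℝ≥0).1 (k : ℝ≥0).1 = 1 := by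
    ext
    simp
  rwa [h1] at h

/-- Letting S range over all realized events characterizes the conditional expectation in (a);
restricting S to latent events gives the tower step of (b). -/
theorem setLIntegral_sq_RV_sub_IV (hN : IsCountingProcess N)
    (hl : ∀ t, Measurable (lam t)) (hs : ∀ t, Measurable (sig t)) (hNm : ∀ t, Measurable (N t))
    (hlc : ∀ ω t, ContinuousWithinAt (fun s => lam s ω) (Iic t) t)
    (hsc : ∀ ω, Continuous fun t => sig t ω)
    (hBm : ∀ t, Measurable (B t)) (hB : IsBrownianReal B μ)
    (hP : ∀ᵐ ω ∂μ, ∀ t ≤ T, P t ω = P 0 ω + timeChangedIntegral B N sig 0 t ω)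
    (hind : IndependentDriver μ B N lam sig) {M : ℕ} {τ : Fin (M + 1) → Ω → ℝ≥0}
    (hτ : IsSamplingGrid T τ) (hτm : ∀ j, Measurable[realizedInfo lam sig N T] (τ j))
    {S : Set Ω} (hS : MeasurableSet[realizedInfo lam sig N T] S) :
    ∫⁻ ω in S, ENNReal.ofReal ((RV P τ ω - IV lam sig 0 T ω) ^ 2) ∂μ
      = ∫⁻ ω in S, ENNReal.ofReal ((rIV N sig 0 T ω - IV lam sig 0 T ω) ^ 2
          + 2 * ∑ j : Fin M, rIV N sig (τ j.castSucc ω) (τ j.succ ω) ω ^ 2) ∂μ := by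
  set F := realizedInfo lam sig N T
  have hF : F ≤ mΩ := realizedInfo_le hl hs hNm
  have hNj : Measurable[NNReal.measurableSpace.prod F] fun p : ℝ≥0 × Ω ↦ N (min p.1 T) p.2 :=
    measurable_uncurry_min_of_rightCont (fun t ht ↦ (measurable_realizedInfo ht).2.2) hN.rightCont
  have hsj : Measurable[NNReal.measurableSpace.prod F] fun p : ℝ≥0 × Ω ↦ sig (min p.1 T) p.2 :=
    measurable_uncurry_min_of_leftCont (fun t ht ↦ (measurable_realizedInfo ht).2.1)
      fun ω t ↦ (hsc ω).continuousWithinAt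
  have hlj : Measurable[NNReal.measurableSpace.prod F] fun p : ℝ≥0 × Ω ↦ lam (min p.1 T) p.2 :=
    measurable_uncurry_min_of_leftCont (fun t ht ↦ (measurable_realizedInfo ht).1) hlc
  -- Capping makes every coefficient measurable for the information up to T. The sums involve only k
  -- < N(T), where the cap is inactive.
  let a : ℕ → Ω → ℝ := fun k ω ↦ sig (cappedArrivalTime N T (k + 1) ω) ω
  have ha (k : ℕ) : Measurable[F] (a k) := by
    have h1 : Measurable[F] (cappedArrivalTime N T (k + 1)) :=
      measurable_cappedArrivalTime hN (fun t ht ↦ (measurable_realizedInfo ht).2.2) _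
    have := hsj.comp (h1.prodMk measurable_id)
    convert this using 1
    ext ω
    simp [a, min_eq_left (hN.cappedArrivalTime_le T (k + 1) ω)]
  let n : Fin (M + 1) → Ω → ℕ := fun j ω ↦ N (τ j ω) ω
  have hn (j) : Measurable[F] (n j) := by
    have := hNj.comp ((hτm j).prodMk measurable_id)
    convert this using 1
    ext ω
    simp [n, min_eq_left (hτ.le j ω)]
  have hnm (ω) : Monotone fun j ↦ n j ω := fun i j hij ↦ hN.mono ω (hτ.mono ω hij)
  have hak {k : ℕ} {ω : Ω} {t : ℝ≥0} (ht : t ≤ T) (hk : k < N t ω) :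
      a k ω = sig (arrivalTime N (k + 1) ω) ω := by
    simp only [a, cappedArrivalTime_of_le (hk.trans_le (hN.mono ω ht))]
  have hc : Measurable[F] (IV lam sig 0 T) := measurable_IV hlj hsj
    measurable_const measurable_const (fun _ ↦ zero_le) fun _ ↦ le_rfl
  obtain ⟨hξ, hξl⟩ := isBrownianReal_unit_increments hB
  have hmξ : Indep F (MeasurableSpace.comap
      (fun ω (k : ℕ) ↦ B (k + 1 : ℕ) ω - B k ω) inferInstance) μ := by
    refine indep_of_indep_of_le_left (indep_of_indep_of_le_right hind.symm ?_)
      realizedInfo_le_comap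
    refine Measurable.comap_le (@measurable_pi_lambda _ _ _ (_) _ _ fun k ↦ ?_)
    have h (t : ℝ≥0) : Measurable[MeasurableSpace.comap (fun ω t ↦ B t ω) inferInstance] (B t) :=
      (measurable_pi_apply (X := fun _ : ℝ≥0 ↦ ℝ) t).comp (comap_measurable _)
    exact (h _).sub (h _)
  have key := setLIntegral_sq_sum_sq_sub_of_indep hξ hξl (fun k ↦ (hBm _).sub (hBm _)) hF hmξ
    ha hn hnm hc hS
  have hr (s t : ℝ≥0) (ht : t ≤ T) (ω : Ω) :
      rIV N sig s t ω = ∑ k ∈ Finset.Ico (N s ω) (N t ω), a k ω ^ 2 := by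
    rw [rIV, jumpIntegral_eq_sum_Ico]
    exact Finset.sum_congr rfl fun k hk ↦ by rw [hak ht (Finset.mem_Ico.1 hk).2]
  have hr0 (ω : Ω) : rIV N sig 0 T ω
      = ∑ j : Fin M, ∑ k ∈ Finset.Ico (n j.castSucc ω) (n j.succ ω), a k ω ^ 2 := by
    rw [sum_sum_Ico_succ (hnm ω) fun k ↦ a k ω ^ 2, hr 0 T le_rfl]
    simp only [n, hτ.first, hτ.last]
  refine (lintegral_congr_ae (ae_restrict_of_ae ?_)).trans (key.trans (lintegral_congr fun ω ↦ ?_))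
  · filter_upwards [hP] with ω hω
    congr 4
    refine Finset.sum_congr rfl fun j _ ↦ ?_
    rw [hω _ (hτ.le _ ω), hω _ (hτ.le _ ω), add_sub_add_left_eq_sub,
      hN.timeChangedIntegral_sub B sig (hτ.mono ω (Fin.castSucc_lt_succ (i := j)).le)]
    congr 1
    exact Finset.sum_congr rfl fun k hk ↦ by
      rw [hak (hτ.le j.succ ω) (Finset.mem_Ico.1 hk).2]
  · rw [hr0]
    congr 4
    ext j
    rw [hr _ _ (hτ.le _ ω)]

end Model


/-! ### Moments of the Poisson distribution -/

/-- The Poisson probability weights, with values in `[0, ∞]`. -/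
noncomputable def poissonWeight (x : ℝ) (k : ℕ) : ℝ≥0∞ :=
  ENNReal.ofReal (Real.exp (-x) * x ^ k / k.factorial)

theorem tsum_poissonWeight {x : ℝ} (hx : 0 ≤ x) : ∑' k, poissonWeight x k = 1 := by
  have h := hasSum_one_poissonMeasure ⟨x, hx⟩
  have h0 (k : ℕ) : 0 ≤ Real.exp (-x) * x ^ k / k.factorial := by positivity
  simp only [poissonWeight]
  rw [← ENNReal.ofReal_tsum_of_nonneg h0 h.summable]
  exact (congrArg ENNReal.ofReal h.tsum_eq).trans ENNReal.ofReal_one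

/-- The recursion lowers the power of k in front of the weight, so both moments below reduce to
total mass one. -/
theorem succ_mul_poissonWeight_succ {x : ℝ} (hx : 0 ≤ x) (k : ℕ) :
    ((k + 1 : ℕ) : ℝ≥0∞) * poissonWeight x (k + 1) = ENNReal.ofReal x * poissonWeight x k := by
  rw [poissonWeight, poissonWeight, ← ENNReal.ofReal_natCast, ← ENNReal.ofReal_mul (by positivity),
    ← ENNReal.ofReal_mul hx, Nat.factorial_succ]
  congr 1
  push_cast
  field_simp
  ring

theorem tsum_natCast_mul_poissonWeight {x : ℝ} (hx : 0 ≤ x) :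
    ∑' k : ℕ, (k : ℝ≥0∞) * poissonWeight x k = ENNReal.ofReal x := by
  rw [tsum_eq_zero_add' ENNReal.summable]
  simp only [succ_mul_poissonWeight_succ hx, ENNReal.tsum_mul_left, tsum_poissonWeight hx]
  simp

theorem tsum_natCast_sq_mul_poissonWeight {x : ℝ} (hx : 0 ≤ x) :
    ∑' k : ℕ, (k : ℝ≥0∞) ^ 2 * poissonWeight x k
      = ENNReal.ofReal x ^ 2 + ENNReal.ofReal x := by
  rw [tsum_eq_zero_add' ENNReal.summable]
  have h (k : ℕ) : ((k + 1 : ℕ) : ℝ≥0∞) ^ 2 * poissonWeight x (k + 1)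
      = ENNReal.ofReal x * (k * poissonWeight x k + poissonWeight x k) := by
    rw [sq, mul_assoc, succ_mul_poissonWeight_succ hx]
    push_cast
    ring
  simp only [h, ENNReal.tsum_mul_left]
  rw [ENNReal.tsum_add, tsum_natCast_mul_poissonWeight hx, tsum_poissonWeight hx]
  simp
  ring

/-! ### The cumulative intensity -/

/-- `∫_s^t λ(r) dr`, with values in `[0, ∞]`. -/
noncomputable def cumIntensity {Ω : Type*} (lam : ℝ≥0 → Ω → ℝ) (s t : ℝ≥0) (ω : Ω) : ℝ≥0∞ :=
  ∫⁻ r in Ioc (s : ℝ) t, ENNReal.ofReal (lam r.toNNReal ω)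

section CumIntensity

variable {Ω : Type*} {lam : ℝ≥0 → Ω → ℝ}

theorem measurable_cumIntensity [MeasurableSpace Ω] (hm : ∀ t, Measurable (lam t))
    (hc : ∀ ω, Continuous fun t ↦ lam t ω) (s t : ℝ≥0) : Measurable (cumIntensity lam s t) := by
  have hj : Measurable fun p : ℝ≥0 × Ω ↦ lam (min p.1 t) p.2 :=
    measurable_uncurry_min_of_leftCont (fun r _ ↦ hm r) fun ω r ↦ (hc ω).continuousWithinAt
  have hp : Measurable fun p : Ω × ℝ ↦ (p.2.toNNReal, p.1) := by fun_prop
  have h := ((hj.comp hp).ennreal_ofReal).lintegral_prod_right'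
    (ν := volume.restrict (Ioc (s : ℝ) t))
  convert h using 1
  ext ω
  refine setLIntegral_congr_fun measurableSet_Ioc fun r hr ↦ ?_
  have : min r.toNNReal t = r.toNNReal := min_eq_left (Real.toNNReal_le_iff_le_coe.2 hr.2)
  simp only [Function.comp, this]

theorem cumIntensity_eq_ofReal (hpos : ∀ t ω, 0 < lam t ω) (hc : ∀ ω, Continuous fun t ↦ lam t ω)
    {s t : ℝ≥0} (hst : s ≤ t) (ω : Ω) :
    cumIntensity lam s t ω = ENNReal.ofReal (∫ r in (s : ℝ)..t, lam r.toNNReal ω) := by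
  have hcont : Continuous fun r : ℝ ↦ lam r.toNNReal ω := (hc ω).comp continuous_real_toNNReal
  rw [intervalIntegral.integral_of_le (NNReal.coe_le_coe.2 hst),
    ofReal_integral_eq_lintegral_ofReal]
  · rfl
  · exact (hcont.intervalIntegrable s t).1
  · exact ae_of_all _ fun r ↦ (hpos _ _).le

theorem cumIntensity_ne_top (hpos : ∀ t ω, 0 < lam t ω) (hc : ∀ ω, Continuous fun t ↦ lam t ω)
    {s t : ℝ≥0} (hst : s ≤ t) (ω : Ω) : cumIntensity lam s t ω ≠ ∞ := by
  rw [cumIntensity_eq_ofReal hpos hc hst]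
  exact ENNReal.ofReal_ne_top

theorem cumIntensity_add {s t : ℝ≥0} (hst : s ≤ t) (ω : Ω) :
    cumIntensity lam 0 s ω + cumIntensity lam s t ω = cumIntensity lam 0 t ω := by
  rw [cumIntensity, cumIntensity, cumIntensity,
    ← lintegral_union measurableSet_Ioc (Ioc_disjoint_Ioc_of_le le_rfl),
    Ioc_union_Ioc_eq_Ioc (by simp) (NNReal.coe_le_coe.2 hst)]

end CumIntensity

/-! ### Moments of a doubly stochastic Poisson process -/

section DoublyStochastic

variable {Ω : Type*} {mΩ : MeasurableSpace Ω} {μ : Measure Ω} [IsProbabilityMeasure μ]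
  {N : ℝ≥0 → Ω → ℕ} {lam : ℝ≥0 → Ω → ℝ}

theorem measurable_fullHistory {E : Type*} [MeasurableSpace E] (X : ℝ≥0 → Ω → E) (t : ℝ≥0) :
    Measurable[fullHistory X] (X t) :=
  (comap_measurable _).mono (le_iSup (fun s ↦ MeasurableSpace.comap (X s) inferInstance) t) le_rfl

theorem measurable_history {E : Type*} [MeasurableSpace E] (X : ℝ≥0 → Ω → E) (t : ℝ≥0) :
    Measurable[history X t] (X t) :=
  (comap_measurable _).mono (le_iSup₂_of_le t le_rfl le_rfl) le_rfl

/-- The conditional law says that μ restricted to the event and μ with the Poisson weight as density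
have the same trim to the conditioning σ-algebra. They therefore integrate every W measurable for it
alike. -/
theorem IsDoublyStochasticPoisson.setLIntegral_eq (h : IsDoublyStochasticPoisson μ N lam)
    (hl : ∀ t, Measurable (lam t)) (hN : ∀ t, Measurable (N t)) (hpos : ∀ t ω, 0 < lam t ω)
    {s t : ℝ≥0} (hst : s ≤ t) {W : Ω → ℝ≥0∞} (hW : Measurable[fullHistory lam ⊔ history N s] W)
    (k : ℕ) :
    ∫⁻ ω in {ω | N t ω = N s ω + k}, W ω ∂μ
      = ∫⁻ ω, W ω * poissonWeight (∫ r in (s : ℝ)..t, lam r.toNNReal ω) k ∂μ := by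
  set x : Ω → ℝ := fun ω ↦ ∫ r in (s : ℝ)..t, lam r.toNNReal ω with hx
  set E : Set Ω := {ω | N t ω = N s ω + k}
  have hE : MeasurableSet E := measurableSet_eq_fun (hN t) ((hN s).add_const k)
  have hG : fullHistory lam ⊔ history N s ≤ mΩ :=
    sup_le (iSup_le fun r ↦ (hl r).comap_le) (iSup₂_le fun r _ ↦ (hN r).comap_le)
  have hx0 (ω) : 0 ≤ x ω :=
    intervalIntegral.integral_nonneg (NNReal.coe_le_coe.2 hst) fun r _ ↦ (hpos _ _).le
  have hxm : Measurable x := by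
    have := (measurable_cumIntensity hl h.lam_continuous s t).ennreal_toReal
    convert this using 1
    ext ω
    rw [cumIntensity_eq_ofReal hpos h.lam_continuous hst, ENNReal.toReal_ofReal (hx0 ω)]
  have hpm : Measurable fun ω ↦ poissonWeight (x ω) k := by
    unfold poissonWeight
    fun_prop
  have hae := h.poisson s t hst k
  have htrim : (μ.restrict E).trim hG
      = (μ.withDensity fun ω ↦ poissonWeight (x ω) k).trim hG := by
    refine @Measure.ext _ (_) _ _ fun A hA ↦ ?_
    rw [trim_measurableSet_eq hG hA, trim_measurableSet_eq hG hA, Measure.restrict_apply (hG _ hA),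
      withDensity_apply _ (hG _ hA)]
    have hint : Integrable (E.indicator fun _ ↦ (1 : ℝ)) μ :=
      (integrable_const 1).indicator hE
    have h1 := setIntegral_condExp hG hint hA
    rw [setIntegral_congr_ae (hG _ hA) (hae.mono fun ω hω _ ↦ hω), integral_indicator hE,
      Measure.restrict_restrict hE, integral_const, smul_eq_mul, mul_one, measureReal_restrict_apply_univ] at h1
    have h2 : IntegrableOn (fun ω ↦ Real.exp (-x ω) * x ω ^ k / k.factorial) A μ :=
      (integrable_condExp.congr hae).integrableOn
    unfold poissonWeight
    rw [← ofReal_integral_eq_lintegral_ofReal h2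
      (ae_of_all _ fun ω ↦ by have := hx0 ω; positivity), h1, inter_comm, ofReal_measureReal]
  have hl' := lintegral_trim (μ := μ.restrict E) hG hW
  rw [htrim, lintegral_trim hG hW, lintegral_withDensity_eq_lintegral_mul _ hpm (hW.mono hG le_rfl)]
    at hl'
  rw [← hl']
  exact lintegral_congr fun ω ↦ mul_comm _ _

theorem IsDoublyStochasticPoisson.lintegral_mul_increment (h : IsDoublyStochasticPoisson μ N lam)
    (hc : IsCountingProcess N)
    (hl : ∀ t, Measurable (lam t)) (hN : ∀ t, Measurable (N t)) (hpos : ∀ t ω, 0 < lam t ω)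
    {s t : ℝ≥0} (hst : s ≤ t) {W : Ω → ℝ≥0∞} (hW : Measurable[fullHistory lam ⊔ history N s] W)
    (φ : ℕ → ℝ≥0∞) :
    ∫⁻ ω, W ω * φ (N t ω - N s ω) ∂μ
      = ∫⁻ ω, W ω * ∑' k, φ k * poissonWeight (∫ r in (s : ℝ)..t, lam r.toNNReal ω) k ∂μ := by
  have hG : fullHistory lam ⊔ history N s ≤ mΩ :=
    sup_le (iSup_le fun r ↦ (hl r).comap_le) (iSup₂_le fun r _ ↦ (hN r).comap_le)
  have hWm : Measurable W := hW.mono hG le_rfl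
  have hE (k : ℕ) : MeasurableSet {ω | N t ω = N s ω + k} :=
    measurableSet_eq_fun (hN t) ((hN s).add_const k)
  have h1 (ω) : W ω * φ (N t ω - N s ω)
      = ∑' k, φ k * {ω | N t ω = N s ω + k}.indicator W ω := by
    have hle := hc.mono ω hst
    rw [tsum_eq_single (N t ω - N s ω), indicator_of_mem, mul_comm]
    · simp only [mem_ofPred_eq]
      simp only at hle
      omega
    · intro k hk
      rw [indicator_of_notMem, mul_zero]
      simp only [mem_ofPred_eq]
      omega
  have hxm (k : ℕ) : Measurable fun ω ↦
      poissonWeight (∫ r in (s : ℝ)..t, lam r.toNNReal ω) k := by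
    have := (measurable_cumIntensity hl h.lam_continuous s t).ennreal_toReal
    have hx : Measurable fun ω ↦ ∫ r in (s : ℝ)..t, lam r.toNNReal ω := by
      convert this using 1
      ext ω
      rw [cumIntensity_eq_ofReal hpos h.lam_continuous hst, ENNReal.toReal_ofReal]
      exact intervalIntegral.integral_nonneg (NNReal.coe_le_coe.2 hst) fun r _ ↦ (hpos _ _).le
    unfold poissonWeight
    fun_prop
  rw [lintegral_congr h1, lintegral_tsum fun k ↦
    ((hWm.indicator (hE k)).const_mul _).aemeasurable]
  simp only [← ENNReal.tsum_mul_left]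
  rw [lintegral_tsum fun k ↦ (by fun_prop)]
  refine tsum_congr fun k ↦ ?_
  rw [lintegral_const_mul _ (hWm.indicator (hE k)), lintegral_indicator (hE k),
    h.setLIntegral_eq hl hN hpos hst hW k, ← lintegral_const_mul _ (by fun_prop)]
  exact lintegral_congr fun ω ↦ by ring

variable (h : IsDoublyStochasticPoisson μ N lam) (hc : IsCountingProcess N)
    (hl : ∀ t, Measurable (lam t)) (hN : ∀ t, Measurable (N t)) (hpos : ∀ t ω, 0 < lam t ω)

include h hc hl hN hpos

theorem IsDoublyStochasticPoisson.lintegral_mul_sub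
    {s t : ℝ≥0} (hst : s ≤ t) {W : Ω → ℝ≥0∞} (hW : Measurable[fullHistory lam ⊔ history N s] W) :
    ∫⁻ ω, W ω * (N t ω - N s ω : ℕ) ∂μ = ∫⁻ ω, W ω * cumIntensity lam s t ω ∂μ := by
  rw [h.lintegral_mul_increment hc hl hN hpos hst hW fun k ↦ k]
  refine lintegral_congr fun ω ↦ ?_
  rw [tsum_natCast_mul_poissonWeight, cumIntensity_eq_ofReal hpos h.lam_continuous hst]
  exact intervalIntegral.integral_nonneg (NNReal.coe_le_coe.2 hst) fun r _ ↦ (hpos _ _).le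

theorem IsDoublyStochasticPoisson.lintegral_mul_apply (t : ℝ≥0) {W : Ω → ℝ≥0∞}
    (hW : Measurable[fullHistory lam] W) :
    ∫⁻ ω, W ω * N t ω ∂μ = ∫⁻ ω, W ω * cumIntensity lam 0 t ω ∂μ := by
  have := h.lintegral_mul_sub hc hl hN hpos (zero_le (a := t)) (hW.mono le_sup_left le_rfl)
  simpa [hc.zero] using this

theorem IsDoublyStochasticPoisson.lintegral_mul_apply_sq (t : ℝ≥0) {W : Ω → ℝ≥0∞}
    (hW : Measurable[fullHistory lam] W) :
    ∫⁻ ω, W ω * (N t ω : ℝ≥0∞) ^ 2 ∂μ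
      = ∫⁻ ω, W ω * (cumIntensity lam 0 t ω ^ 2 + cumIntensity lam 0 t ω) ∂μ := by
  have := h.lintegral_mul_increment hc hl hN hpos (zero_le (a := t)) (hW.mono le_sup_left le_rfl)
    fun k ↦ (k : ℝ≥0∞) ^ 2
  simp only [hc.zero, Nat.sub_zero] at this
  rw [this]
  refine lintegral_congr fun ω ↦ ?_
  rw [tsum_natCast_sq_mul_poissonWeight, cumIntensity_eq_ofReal hpos h.lam_continuous zero_le]
  exact intervalIntegral.integral_nonneg (NNReal.coe_le_coe.2 zero_le) fun r _ ↦ (hpos _ _).le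

/-- Write N(s) N(t) = N(s)² + N(s) (N(t) - N(s)). The weight W N(s) is known at time s, so the
increment may be replaced by its cumulative intensity; then N(s) is replaced by its own. -/
theorem IsDoublyStochasticPoisson.lintegral_mul_apply_mul_apply {s t : ℝ≥0} (hst : s ≤ t)
    {W : Ω → ℝ≥0∞} (hW : Measurable[fullHistory lam] W) :
    ∫⁻ ω, W ω * (N s ω * N t ω) ∂μ
      = ∫⁻ ω, W ω * (cumIntensity lam 0 s ω * cumIntensity lam 0 t ω
          + cumIntensity lam 0 s ω) ∂μ := by
  have hL (s t : ℝ≥0) : Measurable[fullHistory lam] (cumIntensity lam s t) :=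
    @measurable_cumIntensity _ lam (fullHistory lam) (measurable_fullHistory lam) h.lam_continuous s t
  have hF : fullHistory lam ≤ mΩ := iSup_le fun r ↦ (hl r).comap_le
  have hWm : Measurable W := hW.mono hF le_rfl
  have hLm (s t : ℝ≥0) : Measurable (cumIntensity lam s t) := (hL s t).mono hF le_rfl
  have hNm (t : ℝ≥0) : Measurable fun ω ↦ (N t ω : ℝ≥0∞) := measurable_from_nat.comp (hN t)
  have hWN : Measurable[fullHistory lam ⊔ history N s] fun ω ↦ W ω * (N s ω : ℝ≥0∞) :=
    (hW.mono le_sup_left le_rfl).mul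
      (measurable_from_nat.comp ((measurable_history N s).mono le_sup_right le_rfl))
  have h1 (ω) : W ω * (N s ω * N t ω)
      = W ω * (N s ω : ℝ≥0∞) ^ 2 + W ω * N s ω * (N t ω - N s ω : ℕ) := by
    have hle : N s ω ≤ N t ω := hc.mono ω hst
    obtain ⟨d, hd⟩ := Nat.exists_eq_add_of_le hle
    rw [hd, Nat.add_sub_cancel_left]
    push_cast
    ring
  rw [lintegral_congr h1, lintegral_add_left (by fun_prop),
    h.lintegral_mul_apply_sq hc hl hN hpos s hW, h.lintegral_mul_sub hc hl hN hpos hst hWN]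
  have h2 : ∫⁻ ω, W ω * N s ω * cumIntensity lam s t ω ∂μ
      = ∫⁻ ω, W ω * cumIntensity lam s t ω * cumIntensity lam 0 s ω ∂μ := by
    have := h.lintegral_mul_apply hc hl hN hpos s (hW.mul (hL s t))
    simp only [Pi.mul_apply] at this
    rw [← this]
    exact lintegral_congr fun ω ↦ by ring
  rw [h2, ← lintegral_add_left (by fun_prop)]
  refine lintegral_congr fun ω ↦ ?_
  rw [← cumIntensity_add hst]
  ring

end DoublyStochastic


/-! ### Uniqueness of random measures -/

theorem measure_prod_ext_of_Iic {μ ν : Measure (ℝ≥0 × ℝ≥0)} [IsFiniteMeasure μ]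
    (h : ∀ a b, μ (Iic a ×ˢ Iic b) = ν (Iic a ×ˢ Iic b)) : μ = ν := by
  have hspan : IsCountablySpanning (range (Iic : ℝ≥0 → Set ℝ≥0)) := by
    refine ⟨fun n : ℕ ↦ Iic (n : ℝ≥0), fun n ↦ ⟨_, rfl⟩, eq_univ_of_forall fun x ↦ ?_⟩
    obtain ⟨n, hn⟩ := exists_nat_ge x
    exact mem_iUnion.2 ⟨n, hn⟩
  have hgen : MeasurableSpace.generateFrom (range (Iic : ℝ≥0 → Set ℝ≥0))
      = NNReal.measurableSpace := by
    rw [← borel_eq_generateFrom_Iic, ← BorelSpace.measurable_eq]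
  refine Measure.ext_of_generateFrom_of_iUnion
    (image2 (· ×ˢ ·) (range Iic) (range Iic)) (fun n : ℕ ↦ Iic (n : ℝ≥0) ×ˢ Iic (n : ℝ≥0))
    (generateFrom_eq_prod hgen hgen hspan hspan).symm (isPiSystem_Iic.prod isPiSystem_Iic)
    (eq_univ_of_forall fun x ↦ ?_) (fun n ↦ ⟨_, ⟨_, rfl⟩, _, ⟨_, rfl⟩, rfl⟩)
    (fun n ↦ measure_ne_top _ _) ?_
  · obtain ⟨n, hn⟩ := exists_nat_ge (max x.1 x.2)
    exact mem_iUnion.2 ⟨n, (le_max_left _ _).trans hn, (le_max_right _ _).trans hn⟩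
  · rintro _ ⟨_, ⟨a, rfl⟩, _, ⟨b, rfl⟩, rfl⟩
    exact h a b

variable {Ω : Type*} [mΩ : MeasurableSpace Ω]

/-- The kernels need agree only on average over events of (Y, Z), not pointwise: the joint laws of
(Y, Z, x) then coincide on boxes, hence everywhere. Thus the jump measure, which depends on N, can
be compared with its compensator. -/
theorem lintegral_kernel_congr_of_prod {𝒴 𝒵 X : Type*} [MeasurableSpace 𝒴] [MeasurableSpace 𝒵]
    [MeasurableSpace X] {Y : Ω → 𝒴} {Z : Ω → 𝒵} (hY : Measurable Y) (hZ : Measurable Z)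
    (ν : Measure Ω) [IsFiniteMeasure ν] (κ η : Kernel Ω X) [IsSFiniteKernel κ] [IsSFiniteKernel η]
    (hfin : ∫⁻ ω, κ ω univ ∂ν ≠ ∞)
    (h : ∀ A B C, MeasurableSet A → MeasurableSet B → MeasurableSet C →
      ∫⁻ ω in Y ⁻¹' A ∩ Z ⁻¹' B, κ ω C ∂ν = ∫⁻ ω in Y ⁻¹' A ∩ Z ⁻¹' B, η ω C ∂ν)
    {g : 𝒴 × 𝒵 × X → ℝ≥0∞} (hg : Measurable g) :
    ∫⁻ ω, ∫⁻ x, g (Y ω, Z ω, x) ∂κ ω ∂ν = ∫⁻ ω, ∫⁻ x, g (Y ω, Z ω, x) ∂η ω ∂ν := by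
  let Φ : Ω × X → 𝒴 × 𝒵 × X := fun p ↦ (Y p.1, Z p.1, p.2)
  have hΦ : Measurable Φ := by fun_prop
  have hrect (ζ : Kernel Ω X) [IsSFiniteKernel ζ] {A : Set 𝒴} {B : Set 𝒵} {C : Set X}
      (hA : MeasurableSet A) (hB : MeasurableSet B) (hC : MeasurableSet C) :
      (ν ⊗ₘ ζ).map Φ (A ×ˢ B ×ˢ C) = ∫⁻ ω in Y ⁻¹' A ∩ Z ⁻¹' B, ζ ω C ∂ν := by
    rw [Measure.map_apply hΦ (hA.prod (hB.prod hC)),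
      ← Measure.compProd_apply_prod ((hY hA).inter (hZ hB)) hC]
    congr 1
    ext p
    simp [Φ, and_assoc]
  have hint (ζ : Kernel Ω X) [IsSFiniteKernel ζ] :
      ∫⁻ p, g p ∂(ν ⊗ₘ ζ).map Φ = ∫⁻ ω, ∫⁻ x, g (Y ω, Z ω, x) ∂ζ ω ∂ν := by
    rw [lintegral_map hg hΦ]
    exact Measure.lintegral_compProd (hg.comp hΦ)
  have hfin' : IsFiniteMeasure ((ν ⊗ₘ κ).map Φ) := by
    refine ⟨?_⟩
    rw [← univ_prod_univ, ← univ_prod_univ, hrect κ .univ .univ .univ]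
    simpa using hfin.lt_top
  rw [← hint κ, ← hint η]
  congr 1
  refine Measure.ext_prod₃ fun hA hB hC ↦ ?_
  rw [hrect κ hA hB hC, hrect η hA hB hC, h _ _ _ hA hB hC]

theorem isFiniteMeasure_bind_restrict {X : Type*} [MeasurableSpace X] {ν : Measure Ω}
    {κ : Kernel Ω X} (hfin : ∫⁻ ω, κ ω univ ∂ν ≠ ∞) (S : Set Ω) :
    IsFiniteMeasure ((ν.restrict S).bind κ) := by
  refine ⟨?_⟩
  rw [Measure.bind_apply .univ κ.aemeasurable]
  exact (setLIntegral_le_lintegral _ _).trans_lt hfin.lt_top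

/-- This removes the truncation of the cumulative intensity, which is imposed only to make the
measures being compared finite. -/
theorem lintegral_congr_of_setLIntegral_le {ν : Measure Ω} {L f g : Ω → ℝ≥0∞}
    (hL : ∀ ω, L ω ≠ ∞)
    (h : ∀ K : ℕ, ∫⁻ ω in {ω | L ω ≤ K}, f ω ∂ν = ∫⁻ ω in {ω | L ω ≤ K}, g ω ∂ν) :
    ∫⁻ ω, f ω ∂ν = ∫⁻ ω, g ω ∂ν := by
  have hU : ⋃ K : ℕ, {ω | L ω ≤ K} = univ := by
    refine eq_univ_of_forall fun ω ↦ ?_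
    obtain ⟨K, hK⟩ := ENNReal.exists_nat_gt (hL ω)
    exact mem_iUnion.2 ⟨K, hK.le⟩
  have hdir : Directed (· ⊆ ·) fun K : ℕ ↦ {ω | L ω ≤ K} :=
    Monotone.directed_le fun i j hij ω hω ↦
      (show L ω ≤ i from hω).trans (Nat.cast_le.2 hij)
  rw [← setLIntegral_univ f, ← setLIntegral_univ g, ← hU, setLIntegral_iUnion_of_directed _ hdir,
    setLIntegral_iUnion_of_directed _ hdir]
  simp only [h]

/-! ### The jump measure and its compensator as kernels -/

open Classical in
/-- The random measure `∑_{t_i ≤ T} δ_{t_i}` of the arrivals up to time `T`. -/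
noncomputable def jumpKernel {N : ℝ≥0 → Ω → ℕ} (hN : IsCountingProcess N)
    (hm : ∀ t, Measurable (N t)) (T : ℝ≥0) : Kernel Ω ℝ≥0 :=
  Kernel.sum fun k ↦ Kernel.piecewise (s := {ω | k < N T ω}) (hm T measurableSet_Ioi)
    (Kernel.deterministic (cappedArrivalTime N T (k + 1))
      (measurable_cappedArrivalTime hN (fun t _ ↦ hm t) (k + 1))) 0

/-- The random measure `λ(r) dr` on `(0, T]`. -/
noncomputable def intensityKernel (lam : ℝ≥0 → Ω → ℝ) (T : ℝ≥0) : Kernel Ω ℝ≥0 :=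
  Kernel.withDensity (Kernel.const Ω ((volume.restrict (Ioc (0 : ℝ) T)).map Real.toNNReal))
    fun ω r ↦ ((lam (min r T) ω).toNNReal : ℝ≥0∞)

section Kernels

variable {N : ℝ≥0 → Ω → ℕ} (hN : IsCountingProcess N) (hm : ∀ t, Measurable (N t)) (T : ℝ≥0)

instance : IsSFiniteKernel (jumpKernel hN hm T) := by
  unfold jumpKernel
  infer_instance

theorem lintegral_jumpKernel (ω : Ω) {g : ℝ≥0 → ℝ≥0∞} (hg : Measurable g) :
    ∫⁻ r, g r ∂jumpKernel hN hm T ω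
      = ∑ k ∈ Finset.range (N T ω), g (arrivalTime N (k + 1) ω) := by
  rw [jumpKernel, Kernel.sum_apply, lintegral_sum_measure,
    tsum_eq_sum (s := Finset.range (N T ω))]
  · refine Finset.sum_congr rfl fun k hk ↦ ?_
    rw [Finset.mem_range] at hk
    rw [Kernel.lintegral_piecewise, if_pos (show ω ∈ {ω | k < N T ω} from hk),
      Kernel.lintegral_deterministic' _ hg, cappedArrivalTime_of_le hk]
  · intro k hk
    rw [Finset.mem_range] at hk
    rw [Kernel.lintegral_piecewise, if_neg (show ω ∉ {ω | k < N T ω} from hk)]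
    simp

theorem jumpKernel_univ (ω : Ω) : jumpKernel hN hm T ω univ = N T ω := by
  rw [← lintegral_one, lintegral_jumpKernel hN hm T ω measurable_const]
  simp

theorem jumpKernel_Iic (ω : Ω) (a : ℝ≥0) :
    jumpKernel hN hm T ω (Iic a) = N (min a T) ω := by
  rw [← lintegral_indicator_one measurableSet_Iic,
    lintegral_jumpKernel hN hm T ω (measurable_one.indicator measurableSet_Iic)]
  simp only [indicator_apply, Pi.one_apply, mem_Iic]
  rw [← Finset.sum_filter, Finset.sum_const, nsmul_one]
  have : (Finset.range (N T ω)).filter (fun k ↦ arrivalTime N (k + 1) ω ≤ a)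
      = Finset.range (N (min a T) ω) := by
    ext k
    rw [Finset.mem_filter, Finset.mem_range, Finset.mem_range, (hN.mono ω).map_min, lt_min_iff,
      and_comm]
    refine and_congr_left fun hk ↦ ?_
    exact (hN.le_iff_arrivalTime_le (Nat.succ_le_of_lt hk) a).symm
  rw [this, Finset.card_range]

variable {lam : ℝ≥0 → Ω → ℝ}

instance : IsSFiniteKernel (intensityKernel lam T) := by
  unfold intensityKernel
  have : IsFiniteMeasure ((volume.restrict (Ioc (0 : ℝ) T)).map Real.toNNReal) := inferInstance
  infer_instance

theorem lintegral_intensityKernel (hl : ∀ t, Measurable (lam t))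
    (hc : ∀ ω, Continuous fun t ↦ lam t ω) (ω : Ω) {g : ℝ≥0 → ℝ≥0∞} (hg : Measurable g) :
    ∫⁻ r, g r ∂intensityKernel lam T ω
      = ∫⁻ r in Ioc (0 : ℝ) T, ENNReal.ofReal (lam r.toNNReal ω) * g r.toNNReal := by
  have hj : Measurable fun p : ℝ≥0 × Ω ↦ lam (min p.1 T) p.2 :=
    measurable_uncurry_min_of_leftCont (fun r _ ↦ hl r) fun ω r ↦ (hc ω).continuousWithinAt
  have hu : Measurable (Function.uncurry fun ω r ↦ ((lam (min r T) ω).toNNReal : ℝ≥0∞)) :=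
    (hj.comp measurable_swap).real_toNNReal.coe_nnreal_ennreal
  have hw : Measurable fun r ↦ ((lam (min r T) ω).toNNReal : ℝ≥0∞) :=
    hu.comp measurable_prodMk_left
  rw [intensityKernel, Kernel.lintegral_withDensity _ hu _ hg, Kernel.const_apply,
    lintegral_map (by fun_prop) measurable_real_toNNReal]
  refine setLIntegral_congr_fun measurableSet_Ioc fun r hr ↦ ?_
  have : min r.toNNReal T = r.toNNReal := min_eq_left (Real.toNNReal_le_iff_le_coe.2 hr.2)
  simp only [this]
  rfl

theorem intensityKernel_Iic (hl : ∀ t, Measurable (lam t))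
    (hc : ∀ ω, Continuous fun t ↦ lam t ω) (ω : Ω) (a : ℝ≥0) :
    intensityKernel lam T ω (Iic a) = cumIntensity lam 0 (min a T) ω := by
  rw [← lintegral_indicator_one measurableSet_Iic,
    lintegral_intensityKernel T hl hc ω (measurable_one.indicator measurableSet_Iic)]
  have h (r : ℝ) : ENNReal.ofReal (lam r.toNNReal ω) * (Iic a).indicator 1 r.toNNReal
      = (Iic (a : ℝ)).indicator (fun r ↦ ENNReal.ofReal (lam r.toNNReal ω)) r := by
    simp only [indicator_apply, mem_Iic, Pi.one_apply, Real.toNNReal_le_iff_le_coe]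
    split_ifs <;> simp
  rw [lintegral_congr h, lintegral_indicator measurableSet_Iic,
    Measure.restrict_restrict measurableSet_Iic, cumIntensity, inter_comm, Ioc_inter_Iic, min_comm,
    NNReal.coe_zero, NNReal.coe_min]

end Kernels


/-! ### Campbell's formulas given the intensity and the volatility -/

section Campbell

variable {Ω : Type*} [mΩ : MeasurableSpace Ω] {μ : Measure Ω}
  {N : ℝ≥0 → Ω → ℕ} {lam sig : ℝ≥0 → Ω → ℝ}

/-- Both sides factor with the same factor ∫ V. This carries identities for (λ, N) over to weights
that also involve ς. -/
theorem lintegral_mul_congr_of_indepFun {α β : Type*} [MeasurableSpace α] [MeasurableSpace β]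
    {X : Ω → α} {Y : Ω → β} (hX : Measurable X) (hY : Measurable Y) (hXY : IndepFun X Y μ)
    {V f g : Ω → ℝ≥0∞} (hV : Measurable[MeasurableSpace.comap Y inferInstance] V)
    (hf : Measurable[MeasurableSpace.comap X inferInstance] f)
    (hg : Measurable[MeasurableSpace.comap X inferInstance] g)
    (hfg : ∫⁻ ω, f ω ∂μ = ∫⁻ ω, g ω ∂μ) :
    ∫⁻ ω, V ω * f ω ∂μ = ∫⁻ ω, V ω * g ω ∂μ := by
  rw [lintegral_mul_eq_lintegral_mul_lintegral_of_independent_measurableSpace hY.comap_le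
    hX.comap_le hXY.symm hV hf,
    lintegral_mul_eq_lintegral_mul_lintegral_of_independent_measurableSpace hY.comap_le
    hX.comap_le hXY.symm hV hg, hfg]

theorem exists_eq_comp_of_measurable_comap_prod {Ω α β : Type*} [MeasurableSpace α]
    [MeasurableSpace β] {Y : Ω → α} {φ : Ω × β → ℝ≥0∞}
    (hφ : Measurable[(MeasurableSpace.comap Y inferInstance).prod inferInstance] φ) :
    ∃ φ' : α × β → ℝ≥0∞, Measurable φ' ∧ ∀ ω r, φ (ω, r) = φ' (Y ω, r) := by
  have h : (MeasurableSpace.comap Y inferInstance).prod (inferInstance : MeasurableSpace β)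
      = MeasurableSpace.comap (Prod.map Y id) inferInstance := by
    simp only [Prod.instMeasurableSpace, MeasurableSpace.prod, MeasurableSpace.comap_sup,
      MeasurableSpace.comap_comp]
    rfl
  rw [h] at hφ
  obtain ⟨φ', hφ', rfl⟩ := hφ.exists_eq_measurable_comp
  exact ⟨φ', hφ', fun _ _ ↦ rfl⟩

variable [IsProbabilityMeasure μ] (h : IsDoublyStochasticPoisson μ N lam) (hc : IsCountingProcess N)
    (hl : ∀ t, Measurable (lam t)) (hN : ∀ t, Measurable (N t)) (hpos : ∀ t ω, 0 < lam t ω)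
    (hs : ∀ t, Measurable (sig t))
    (hind : IndepFun (fun ω t ↦ (lam t ω, N t ω)) (fun ω t ↦ sig t ω) μ)

include h hc hl hN hpos hs hind

/-- These are the Campbell identities on a generating π-system. The λ-event and the truncation enter
as a λ-measurable weight W, the ς-event as an independent factor V. -/
theorem IsDoublyStochasticPoisson.setLIntegral_jumpKernel_Iic (T : ℝ≥0) (K : ℝ≥0∞)
    {A B : Set (ℝ≥0 → ℝ)} (hA : MeasurableSet A) (hB : MeasurableSet B) (a b : ℝ≥0) :
    (∫⁻ ω in (fun ω t ↦ lam t ω) ⁻¹' A ∩ (fun ω t ↦ sig t ω) ⁻¹' B,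
        N (min a T) ω ∂(μ.restrict {ω | cumIntensity lam 0 T ω ≤ K})
      = ∫⁻ ω in (fun ω t ↦ lam t ω) ⁻¹' A ∩ (fun ω t ↦ sig t ω) ⁻¹' B,
        cumIntensity lam 0 (min a T) ω ∂(μ.restrict {ω | cumIntensity lam 0 T ω ≤ K})) ∧
    ∫⁻ ω in (fun ω t ↦ lam t ω) ⁻¹' A ∩ (fun ω t ↦ sig t ω) ⁻¹' B,
        N (min a T) ω * N (min b T) ω ∂(μ.restrict {ω | cumIntensity lam 0 T ω ≤ K})
      = ∫⁻ ω in (fun ω t ↦ lam t ω) ⁻¹' A ∩ (fun ω t ↦ sig t ω) ⁻¹' B,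
        (cumIntensity lam 0 (min a T) ω * cumIntensity lam 0 (min b T) ω
          + cumIntensity lam 0 (min (min a T) (min b T)) ω)
          ∂(μ.restrict {ω | cumIntensity lam 0 T ω ≤ K}) := by
  have hL (s t : ℝ≥0) : Measurable[fullHistory lam] (cumIntensity lam s t) :=
    @measurable_cumIntensity _ lam (fullHistory lam) (measurable_fullHistory lam)
      h.lam_continuous s t
  have hlp : Measurable[fullHistory lam] fun ω t ↦ lam t ω :=
    @measurable_pi_lambda _ _ _ (fullHistory lam) _ _ (measurable_fullHistory lam)
  let D : Set Ω := (fun ω t ↦ lam t ω) ⁻¹' A ∩ {ω | cumIntensity lam 0 T ω ≤ K}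
  have hD : MeasurableSet[fullHistory lam] D := (hlp hA).inter (hL 0 T measurableSet_Iic)
  let W : Ω → ℝ≥0∞ := D.indicator 1
  have hW : Measurable[fullHistory lam] W := Measurable.indicator measurable_const hD
  let V : Ω → ℝ≥0∞ := ((fun ω t ↦ sig t ω) ⁻¹' B).indicator 1
  have hV : Measurable[MeasurableSpace.comap (fun ω t ↦ sig t ω) inferInstance] V :=
    Measurable.indicator measurable_const ⟨B, hB, rfl⟩
  have hF : fullHistory lam ≤ mΩ := iSup_le fun r ↦ (hl r).comap_le
  have hsm : Measurable fun ω t ↦ sig t ω := measurable_pi_lambda _ hs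
  have hX : Measurable fun ω t ↦ (lam t ω, N t ω) :=
    measurable_pi_lambda _ fun t ↦ (hl t).prodMk (hN t)
  have hset (f : Ω → ℝ≥0∞) :
      ∫⁻ ω in (fun ω t ↦ lam t ω) ⁻¹' A ∩ (fun ω t ↦ sig t ω) ⁻¹' B, f ω
        ∂(μ.restrict {ω | cumIntensity lam 0 T ω ≤ K}) = ∫⁻ ω, V ω * (W ω * f ω) ∂μ := by
    have hAB : MeasurableSet ((fun ω t ↦ lam t ω) ⁻¹' A ∩ (fun ω t ↦ sig t ω) ⁻¹' B) :=
      (hF _ (hlp hA)).inter (hsm hB)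
    have hK : MeasurableSet {ω | cumIntensity lam 0 T ω ≤ K} := hF _ (hL 0 T measurableSet_Iic)
    rw [Measure.restrict_restrict hAB, ← lintegral_indicator (hAB.inter hK)]
    classical
    refine lintegral_congr fun ω ↦ ?_
    by_cases h1 : ω ∈ (fun ω t ↦ lam t ω) ⁻¹' A <;>
    by_cases h2 : ω ∈ (fun ω t ↦ sig t ω) ⁻¹' B <;>
    by_cases h3 : ω ∈ {ω | cumIntensity lam 0 T ω ≤ K} <;>
    simp only [V, W, D, indicator_apply, mem_inter_iff, h1, h2, h3] <;> simp
  have hcoord (t : ℝ≥0) : Measurable[MeasurableSpace.comap (fun ω t ↦ (lam t ω, N t ω))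
      inferInstance] fun ω ↦ (lam t ω, N t ω) :=
    (measurable_pi_apply (X := fun _ : ℝ≥0 ↦ ℝ × ℕ) t).comp (comap_measurable _)
  have hle : fullHistory lam ≤ MeasurableSpace.comap (fun ω t ↦ (lam t ω, N t ω)) inferInstance :=
    iSup_le fun t ↦ (measurable_fst.comp (hcoord t)).comap_le
  have hNX (t : ℝ≥0) : Measurable[MeasurableSpace.comap (fun ω t ↦ (lam t ω, N t ω))
      inferInstance] fun ω ↦ (N t ω : ℝ≥0∞) :=
    measurable_from_nat.comp (measurable_snd.comp (hcoord t))
  have hLX (t : ℝ≥0) : Measurable[MeasurableSpace.comap (fun ω t ↦ (lam t ω, N t ω))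
      inferInstance] (cumIntensity lam 0 t) := (hL 0 t).mono hle le_rfl
  have hWX := hW.mono hle le_rfl
  have hord {s t : ℝ≥0} (hst : s ≤ t) :
      ∫⁻ ω, V ω * (W ω * (N s ω * N t ω)) ∂μ
        = ∫⁻ ω, V ω * (W ω * (cumIntensity lam 0 s ω * cumIntensity lam 0 t ω
          + cumIntensity lam 0 s ω)) ∂μ :=
    lintegral_mul_congr_of_indepFun hX hsm hind hV (hWX.mul ((hNX s).mul (hNX t)))
      (hWX.mul (((hLX s).mul (hLX t)).add (hLX s)))
      (h.lintegral_mul_apply_mul_apply hc hl hN hpos hst hW)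
  rw [hset, hset, hset, hset]
  refine ⟨lintegral_mul_congr_of_indepFun hX hsm hind hV (hWX.mul (hNX _)) (hWX.mul (hLX _))
    (h.lintegral_mul_apply hc hl hN hpos _ hW), ?_⟩
  rcases le_total (min a T) (min b T) with hab | hab
  · rw [min_eq_left hab, hord hab]
  · rw [min_eq_right hab, lintegral_congr fun ω ↦ by rw [mul_comm (N (min a T) ω : ℝ≥0∞)],
      hord hab]
    exact lintegral_congr fun ω ↦ by rw [mul_comm (cumIntensity lam 0 (min b T) ω)]

theorem IsDoublyStochasticPoisson.setLIntegral_lintegral_jumpKernel (T : ℝ≥0) (K : ℕ)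
    {g : (ℝ≥0 → ℝ) × (ℝ≥0 → ℝ) × ℝ≥0 → ℝ≥0∞} (hg : Measurable g) :
    ∫⁻ ω in {ω | cumIntensity lam 0 T ω ≤ K},
        ∫⁻ r, g (fun t ↦ lam t ω, fun t ↦ sig t ω, r) ∂jumpKernel hc hN T ω ∂μ
      = ∫⁻ ω in {ω | cumIntensity lam 0 T ω ≤ K},
        ∫⁻ r, g (fun t ↦ lam t ω, fun t ↦ sig t ω, r) ∂intensityKernel lam T ω ∂μ := by
  have hK (ω) (hω : ω ∈ {ω | cumIntensity lam 0 T ω ≤ K}) : cumIntensity lam 0 T ω ≤ K := hω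
  have hfin : ∫⁻ ω, jumpKernel hc hN T ω univ ∂(μ.restrict {ω | cumIntensity lam 0 T ω ≤ K})
      ≠ ∞ := by
    have := (h.setLIntegral_jumpKernel_Iic hc hl hN hpos hs hind T K .univ .univ T T).1
    simp only [preimage_univ, inter_univ, Measure.restrict_univ, min_self] at this
    simp only [jumpKernel_univ, this]
    exact ((setLIntegral_mono measurable_const hK).trans_lt (by simp [ENNReal.mul_lt_top])).ne
  refine lintegral_kernel_congr_of_prod (measurable_pi_lambda _ hl) (measurable_pi_lambda _ hs)
    _ _ _ hfin (fun A B C hA hB hC ↦ ?_) hg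
  have := isFiniteMeasure_bind_restrict hfin ((fun ω t ↦ lam t ω) ⁻¹' A ∩ (fun ω t ↦ sig t ω) ⁻¹' B)
  rw [← Measure.bind_apply hC (Kernel.aemeasurable _),
    ← Measure.bind_apply hC (Kernel.aemeasurable _)]
  congr 1
  refine Measure.ext_of_Iic _ _ fun a ↦ ?_
  rw [Measure.bind_apply measurableSet_Iic (Kernel.aemeasurable _),
    Measure.bind_apply measurableSet_Iic (Kernel.aemeasurable _)]
  simp only [jumpKernel_Iic, intensityKernel_Iic T hl h.lam_continuous]
  exact (h.setLIntegral_jumpKernel_Iic hc hl hN hpos hs hind T K hA hB a a).1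

/-- Pairs of distinct arrivals account for the product of the intensity with itself; each arrival
paired with itself adds a copy of the intensity on the diagonal. -/
theorem IsDoublyStochasticPoisson.setLIntegral_lintegral_jumpKernel_prod (T : ℝ≥0) (K : ℕ)
    {g : (ℝ≥0 → ℝ) × (ℝ≥0 → ℝ) × ℝ≥0 × ℝ≥0 → ℝ≥0∞} (hg : Measurable g) :
    ∫⁻ ω in {ω | cumIntensity lam 0 T ω ≤ K},
        ∫⁻ r, g (fun t ↦ lam t ω, fun t ↦ sig t ω, r)
          ∂(jumpKernel hc hN T ×ₖ jumpKernel hc hN T) ω ∂μ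
      = ∫⁻ ω in {ω | cumIntensity lam 0 T ω ≤ K},
        ∫⁻ r, g (fun t ↦ lam t ω, fun t ↦ sig t ω, r)
          ∂(intensityKernel lam T ×ₖ intensityKernel lam T
            + (intensityKernel lam T).map fun r ↦ (r, r)) ω ∂μ := by
  have hK (ω) (hω : ω ∈ {ω | cumIntensity lam 0 T ω ≤ K}) :
      cumIntensity lam 0 T ω * cumIntensity lam 0 T ω + cumIntensity lam 0 T ω
        ≤ (K : ℝ≥0∞) * K + K := by
    have hω' : cumIntensity lam 0 T ω ≤ K := hω
    gcongr
  have hfin : ∫⁻ ω, (jumpKernel hc hN T ×ₖ jumpKernel hc hN T) ω univ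
      ∂(μ.restrict {ω | cumIntensity lam 0 T ω ≤ K}) ≠ ∞ := by
    have := (h.setLIntegral_jumpKernel_Iic hc hl hN hpos hs hind T K .univ .univ T T).2
    simp only [preimage_univ, inter_univ, Measure.restrict_univ, min_self] at this
    simp only [Kernel.prod_apply, ← univ_prod_univ, Measure.prod_prod, jumpKernel_univ, this]
    exact ((setLIntegral_mono measurable_const hK).trans_lt
      (by simp [ENNReal.mul_lt_top, ENNReal.add_lt_top])).ne
  have hdiag : Measurable fun r : ℝ≥0 ↦ (r, r) := by fun_prop
  refine lintegral_kernel_congr_of_prod (measurable_pi_lambda _ hl) (measurable_pi_lambda _ hs)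
    _ _ _ hfin (fun A B C hA hB hC ↦ ?_) hg
  have := isFiniteMeasure_bind_restrict hfin ((fun ω t ↦ lam t ω) ⁻¹' A ∩ (fun ω t ↦ sig t ω) ⁻¹' B)
  rw [← Measure.bind_apply hC (Kernel.aemeasurable _),
    ← Measure.bind_apply hC (Kernel.aemeasurable _)]
  congr 1
  refine measure_prod_ext_of_Iic fun a b ↦ ?_
  have hab : MeasurableSet (Iic a ×ˢ Iic b) := measurableSet_Iic.prod measurableSet_Iic
  have hpre : (fun r : ℝ≥0 ↦ (r, r)) ⁻¹' (Iic a ×ˢ Iic b) = Iic (min a b) := by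
    ext r
    simp
  rw [Measure.bind_apply hab (Kernel.aemeasurable _),
    Measure.bind_apply hab (Kernel.aemeasurable _)]
  simp only [add_apply, Measure.add_apply, Kernel.prod_apply, Measure.prod_prod,
    Kernel.map_apply _ hdiag, Measure.map_apply hdiag hab, hpre, jumpKernel_Iic,
    intensityKernel_Iic T hl h.lam_continuous]
  rw [(h.setLIntegral_jumpKernel_Iic hc hl hN hpos hs hind T K hA hB a b).2]
  have hmin : min (min a b) T = min (min a T) (min b T) := inf_inf_distrib_right a b T
  simp only [hmin]

theorem IsDoublyStochasticPoisson.lintegral_mul_lintegral_jumpKernel (T : ℝ≥0)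
    {w : Ω → ℝ≥0∞} (hw : Measurable[MeasurableSpace.comap
      (fun ω ↦ (fun t ↦ lam t ω, fun t ↦ sig t ω)) inferInstance] w) {φ : Ω × ℝ≥0 → ℝ≥0∞}
    (hφ : Measurable[(MeasurableSpace.comap
      (fun ω ↦ (fun t ↦ lam t ω, fun t ↦ sig t ω)) inferInstance).prod NNReal.measurableSpace] φ) :
    ∫⁻ ω, w ω * ∫⁻ r, φ (ω, r) ∂jumpKernel hc hN T ω ∂μ
      = ∫⁻ ω, w ω * ∫⁻ r, φ (ω, r) ∂intensityKernel lam T ω ∂μ := by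
  obtain ⟨w', hw', rfl⟩ := hw.exists_eq_measurable_comp
  obtain ⟨φ', hφ', hφe⟩ := exists_eq_comp_of_measurable_comap_prod hφ
  refine lintegral_congr_of_setLIntegral_le (L := cumIntensity lam 0 T)
    (cumIntensity_ne_top hpos h.lam_continuous zero_le) fun K ↦ ?_
  have key := h.setLIntegral_lintegral_jumpKernel hc hl hN hpos hs hind T K
    (g := fun p ↦ w' (p.1, p.2.1) * φ' ((p.1, p.2.1), p.2.2)) (by fun_prop)
  have hm (y : (ℝ≥0 → ℝ) × (ℝ≥0 → ℝ)) : Measurable fun r ↦ φ' (y, r) := by fun_prop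
  simpa only [lintegral_const_mul _ (hm _), hφe, Function.comp_apply] using key

/-- The square is a double integral against the jump measure; the diagonal of the second moment
measure produces the φ² term, and with φ = ς² this is the source of IQ. -/
theorem IsDoublyStochasticPoisson.lintegral_mul_lintegral_jumpKernel_sq (T : ℝ≥0)
    {w : Ω → ℝ≥0∞} (hw : Measurable[MeasurableSpace.comap
      (fun ω ↦ (fun t ↦ lam t ω, fun t ↦ sig t ω)) inferInstance] w) {φ : Ω × ℝ≥0 → ℝ≥0∞}
    (hφ : Measurable[(MeasurableSpace.comap
      (fun ω ↦ (fun t ↦ lam t ω, fun t ↦ sig t ω)) inferInstance).prod NNReal.measurableSpace] φ) :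
    ∫⁻ ω, w ω * (∫⁻ r, φ (ω, r) ∂jumpKernel hc hN T ω) ^ 2 ∂μ
      = ∫⁻ ω, w ω * ((∫⁻ r, φ (ω, r) ∂intensityKernel lam T ω) ^ 2
          + ∫⁻ r, φ (ω, r) ^ 2 ∂intensityKernel lam T ω) ∂μ := by
  obtain ⟨w', hw', rfl⟩ := hw.exists_eq_measurable_comp
  obtain ⟨φ', hφ', hφe⟩ := exists_eq_comp_of_measurable_comap_prod hφ
  refine lintegral_congr_of_setLIntegral_le (L := cumIntensity lam 0 T)
    (cumIntensity_ne_top hpos h.lam_continuous zero_le) fun K ↦ ?_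
  have key := h.setLIntegral_lintegral_jumpKernel_prod hc hl hN hpos hs hind T K
    (g := fun p ↦ w' (p.1, p.2.1) * (φ' ((p.1, p.2.1), p.2.2.1) * φ' ((p.1, p.2.1), p.2.2.2)))
    (by fun_prop)
  have hm (y : (ℝ≥0 → ℝ) × (ℝ≥0 → ℝ)) : Measurable fun r ↦ φ' (y, r) := by fun_prop
  have hm2 (y : (ℝ≥0 → ℝ) × (ℝ≥0 → ℝ)) :
      Measurable fun r : ℝ≥0 × ℝ≥0 ↦ φ' (y, r.1) * φ' (y, r.2) := by fun_prop
  have hdiag : Measurable fun r : ℝ≥0 ↦ (r, r) := by fun_prop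
  simp only [lintegral_const_mul _ (hm2 _), Kernel.prod_apply, add_apply,
    Kernel.map_apply _ hdiag, lintegral_add_measure, lintegral_map (hm2 _) hdiag,
    lintegral_prod_mul (hm _).aemeasurable (hm _).aemeasurable] at key
  simpa only [hφe, sq, Function.comp_apply] using key

end Campbell


/-! ### The squared error given the latent information -/

theorem condLExp_congr_of_setLIntegral_eq {Ω : Type*} {m mΩ : MeasurableSpace Ω} {μ : Measure Ω}
    [IsFiniteMeasure μ] (hm : m ≤ mΩ) {f g : Ω → ℝ≥0∞}
    (hfg : ∀ S, MeasurableSet[m] S → ∫⁻ ω in S, f ω ∂μ = ∫⁻ ω in S, g ω ∂μ) :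
    μ⁻[f | m] =ᵐ[μ] μ⁻[g | m] :=
  ae_eq_condLExp hm μ g (measurable_condLExp m μ f) fun S hS ↦
    (setLIntegral_condLExp hm μ f hS).trans (hfg S hS)

section Moments

variable {Ω : Type*} [mΩ : MeasurableSpace Ω] {μ : Measure Ω} {T : ℝ≥0}
  {N : ℝ≥0 → Ω → ℕ} {lam sig : ℝ≥0 → Ω → ℝ}

theorem lintegral_jumpKernel_indicator (hN : IsCountingProcess N) (hm : ∀ t, Measurable (N t))
    (hs : ∀ ω, Continuous fun t ↦ sig t ω) {a b : ℝ≥0} (hb : b ≤ T) (ω : Ω) :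
    ∫⁻ r, (Ioc a b).indicator (fun r ↦ ENNReal.ofReal (sig r ω ^ 2)) r ∂jumpKernel hN hm T ω
      = ENNReal.ofReal (rIV N sig a b ω) := by
  have hsm : Measurable fun r ↦ sig r ω := (hs ω).measurable
  rw [lintegral_jumpKernel hN hm T ω (Measurable.indicator (by fun_prop) measurableSet_Ioc), rIV,
    jumpIntegral_eq_sum_Ico, ENNReal.ofReal_sum_of_nonneg fun k _ ↦ sq_nonneg _]
  simp only [indicator_apply]
  rw [← Finset.sum_filter]
  refine Finset.sum_congr ?_ fun _ _ ↦ rfl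
  ext k
  rw [Finset.mem_filter, Finset.mem_range, Finset.mem_Ico, mem_Ioc]
  constructor
  · rintro ⟨hk, h1, h2⟩
    have h (u) := hN.le_iff_arrivalTime_le (Nat.succ_le_of_lt hk) u
    exact ⟨not_lt.1 fun h' ↦ h1.not_ge ((h a).1 h'), (h b).2 h2⟩
  · rintro ⟨h1, h2⟩
    have hk : k < N T ω := h2.trans_le (hN.mono ω hb)
    have h (u) := hN.le_iff_arrivalTime_le (Nat.succ_le_of_lt hk) u
    exact ⟨hk, not_le.1 fun h' ↦ h1.not_gt ((h a).2 h'), (h b).1 h2⟩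

theorem lintegral_intensityKernel_indicator (hl : ∀ t, Measurable (lam t))
    (hc : ∀ ω, Continuous fun t ↦ lam t ω) (hpos : ∀ t ω, 0 < lam t ω) {f : ℝ≥0 → ℝ}
    (hf : Continuous f) (hf0 : ∀ r, 0 ≤ f r) {a b : ℝ≥0} (hab : a ≤ b) (hb : b ≤ T) (ω : Ω) :
    ∫⁻ r, (Ioc a b).indicator (fun r ↦ ENNReal.ofReal (f r)) r ∂intensityKernel lam T ω
      = ENNReal.ofReal (∫ r in (a : ℝ)..b, f r.toNNReal * lam r.toNNReal ω) := by
  have hcont : Continuous fun r : ℝ ↦ f r.toNNReal * lam r.toNNReal ω :=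
    (hf.comp continuous_real_toNNReal).mul ((hc ω).comp continuous_real_toNNReal)
  have hfm := hf.measurable
  rw [lintegral_intensityKernel T hl hc ω (Measurable.indicator (by fun_prop) measurableSet_Ioc),
    intervalIntegral.integral_of_le (NNReal.coe_le_coe.2 hab),
    ofReal_integral_eq_lintegral_ofReal (hcont.intervalIntegrable a b).1
      (ae_of_all _ fun r ↦ mul_nonneg (hf0 _) (hpos _ _).le),
    ← lintegral_indicator measurableSet_Ioc, ← lintegral_indicator measurableSet_Ioc]
  refine lintegral_congr fun r ↦ ?_
  by_cases hr : r ∈ Ioc (a : ℝ) b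
  · have h0 : 0 ≤ r := a.coe_nonneg.trans hr.1.le
    have hr' : r.toNNReal ∈ Ioc a b :=
      ⟨NNReal.coe_lt_coe.1 (by rw [Real.coe_toNNReal r h0]; exact hr.1),
        Real.toNNReal_le_iff_le_coe.2 hr.2⟩
    have hr'' : r ∈ Ioc (0 : ℝ) T :=
      ⟨a.coe_nonneg.trans_lt hr.1, hr.2.trans (NNReal.coe_le_coe.2 hb)⟩
    rw [indicator_of_mem hr, indicator_of_mem hr'', indicator_of_mem hr',
      ENNReal.ofReal_mul (hf0 _), mul_comm]
  · rw [indicator_of_notMem hr]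
    by_cases hr'' : r ∈ Ioc (0 : ℝ) T
    · have hr' : r.toNNReal ∉ Ioc a b := by
        intro h
        refine hr ⟨?_, Real.toNNReal_le_iff_le_coe.1 h.2⟩
        rw [← Real.coe_toNNReal r hr''.1.le]
        exact NNReal.coe_lt_coe.2 h.1
      rw [indicator_of_mem hr'', indicator_of_notMem hr', mul_zero]
    · rw [indicator_of_notMem hr'']

variable [IsProbabilityMeasure μ] (h : IsDoublyStochasticPoisson μ N lam)
    (hc : IsCountingProcess N)
    (hl : ∀ t, Measurable (lam t)) (hN : ∀ t, Measurable (N t)) (hpos : ∀ t ω, 0 < lam t ω)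
    (hs : ∀ t, Measurable (sig t)) (hsc : ∀ ω, Continuous fun t ↦ sig t ω)
    (hind : IndepFun (fun ω t ↦ (lam t ω, N t ω)) (fun ω t ↦ sig t ω) μ)

include h hc hl hN hpos hs hsc hind

/-- Campbell's formulas applied to ς² times the indicator of (a, b]. Latent-measurable endpoints
make this integrand a function of the λ- and ς-paths and time. -/
theorem IsDoublyStochasticPoisson.lintegral_mul_rIV {a b : Ω → ℝ≥0}
    (ha : Measurable[latentInfo lam sig T] a) (hb : Measurable[latentInfo lam sig T] b)
    (hab : ∀ ω, a ω ≤ b ω) (hbT : ∀ ω, b ω ≤ T) {w : Ω → ℝ≥0∞}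
    (hw : Measurable[latentInfo lam sig T] w) :
    (∫⁻ ω, w ω * ENNReal.ofReal (rIV N sig (a ω) (b ω) ω) ∂μ
      = ∫⁻ ω, w ω * ENNReal.ofReal (IV lam sig (a ω) (b ω) ω) ∂μ) ∧
    ∫⁻ ω, w ω * ENNReal.ofReal (rIV N sig (a ω) (b ω) ω) ^ 2 ∂μ
      = ∫⁻ ω, w ω * (ENNReal.ofReal (IV lam sig (a ω) (b ω) ω) ^ 2
          + ENNReal.ofReal (IQ lam sig (a ω) (b ω) ω)) ∂μ := by
  let φ : Ω × ℝ≥0 → ℝ≥0∞ := fun p ↦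
    (Ioc (a p.1) (b p.1)).indicator (fun r ↦ ENNReal.ofReal (sig r p.1 ^ 2)) p.2
  have hφ : Measurable[(latentInfo lam sig T).prod NNReal.measurableSpace] φ := by
    have hsj : Measurable[NNReal.measurableSpace.prod (latentInfo lam sig T)]
        fun p : ℝ≥0 × Ω ↦ sig (min p.1 T) p.2 :=
      measurable_uncurry_min_of_leftCont (fun t ht ↦ (measurable_latentInfo ht).2)
        fun ω t ↦ (hsc ω).continuousWithinAt
    have h1 : MeasurableSet[(latentInfo lam sig T).prod NNReal.measurableSpace]
        {p : Ω × ℝ≥0 | a p.1 < p.2} :=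
      measurableSet_lt (ha.comp measurable_fst) measurable_snd
    have h2 : MeasurableSet[(latentInfo lam sig T).prod NNReal.measurableSpace]
        {p : Ω × ℝ≥0 | p.2 ≤ b p.1} :=
      measurableSet_le measurable_snd (hb.comp measurable_fst)
    have h3 := (((hsj.comp measurable_swap).pow_const 2).ennreal_ofReal).indicator (h1.inter h2)
    suffices φ = _ by
      rw [this]
      exact h3
    funext p
    by_cases hp : p.2 ∈ Ioc (a p.1) (b p.1)
    · have hpT : min p.2 T = p.2 := min_eq_left (hp.2.trans (hbT _))
      simp only [φ]
      rw [indicator_of_mem hp, indicator_of_mem (by exact hp)]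
      simp [hpT]
    · simp only [φ]
      rw [indicator_of_notMem hp, indicator_of_notMem (by exact hp)]
  have hle := latentInfo_le_comap (lam := lam) (sig := sig) (T := T)
  have hφ' := hφ.mono (sup_le_sup (MeasurableSpace.comap_mono hle) le_rfl) le_rfl
  have hw' := hw.mono hle le_rfl
  have e1 (ω) : ∫⁻ r, φ (ω, r) ∂jumpKernel hc hN T ω
      = ENNReal.ofReal (rIV N sig (a ω) (b ω) ω) :=
    lintegral_jumpKernel_indicator (a := a ω) hc hN hsc (hbT ω) ω
  have e2 (ω) : ∫⁻ r, φ (ω, r) ∂intensityKernel lam T ω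
      = ENNReal.ofReal (IV lam sig (a ω) (b ω) ω) :=
    lintegral_intensityKernel_indicator hl h.lam_continuous hpos ((hsc ω).pow 2)
      (fun r ↦ sq_nonneg _) (hab ω) (hbT ω) ω
  have e3 (ω) : ∫⁻ r, φ (ω, r) ^ 2 ∂intensityKernel lam T ω
      = ENNReal.ofReal (IQ lam sig (a ω) (b ω) ω) := by
    have := lintegral_intensityKernel_indicator hl h.lam_continuous hpos ((hsc ω).pow 4)
      (fun r ↦ Even.pow_nonneg (by decide) (sig r ω)) (hab ω) (hbT ω) ω
    refine Eq.trans (lintegral_congr fun r ↦ ?_) this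
    simp only [φ, indicator_apply]
    split_ifs
    · rw [← ENNReal.ofReal_pow (sq_nonneg _), ← pow_mul]
      rfl
    · simp
  have c1 := h.lintegral_mul_lintegral_jumpKernel hc hl hN hpos hs hind T hw' hφ'
  have c2 := h.lintegral_mul_lintegral_jumpKernel_sq hc hl hN hpos hs hind T hw' hφ'
  simp only [e1, e2, e3] at c1 c2
  exact ⟨c1, c2⟩

/-- Given the latent information, rIV has mean IV and variance IQ on every sampling interval. To
avoid subtraction in [0, ∞], the cross term 2 IV · rIV is added to both sides and cancelled at the
end. -/
theorem IsDoublyStochasticPoisson.condLExp_sq_rIV_sub_IV {M : ℕ} {τ : Fin (M + 1) → Ω → ℝ≥0}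
    (hτ : IsSamplingGrid T τ) (hτm : ∀ j, Measurable[latentInfo lam sig T] (τ j)) :
    μ⁻[fun ω ↦ ENNReal.ofReal ((rIV N sig 0 T ω - IV lam sig 0 T ω) ^ 2
          + 2 * ∑ j : Fin M, rIV N sig (τ j.castSucc ω) (τ j.succ ω) ω ^ 2)
        | latentInfo lam sig T]
      =ᵐ[μ] fun ω ↦ ENNReal.ofReal (3 * IQ lam sig 0 T ω
            + 2 * ∑ j : Fin M, IV lam sig (τ j.castSucc ω) (τ j.succ ω) ω ^ 2) := by
  have hFm : latentInfo lam sig T ≤ mΩ :=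
    latentInfo_le_realizedInfo.trans (realizedInfo_le hl hs hN)
  have hsj : Measurable[NNReal.measurableSpace.prod (latentInfo lam sig T)]
      fun p : ℝ≥0 × Ω ↦ sig (min p.1 T) p.2 :=
    measurable_uncurry_min_of_leftCont (fun t ht ↦ (measurable_latentInfo ht).2)
      fun ω t ↦ (hsc ω).continuousWithinAt
  have hlj : Measurable[NNReal.measurableSpace.prod (latentInfo lam sig T)]
      fun p : ℝ≥0 × Ω ↦ lam (min p.1 T) p.2 :=
    measurable_uncurry_min_of_leftCont (fun t ht ↦ (measurable_latentInfo ht).1)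
      fun ω t ↦ (h.lam_continuous ω).continuousWithinAt
  have hstep (j : Fin M) (ω) : τ j.castSucc ω ≤ τ j.succ ω :=
    hτ.mono ω (Fin.castSucc_lt_succ (i := j)).le
  have hJm : Measurable fun ω ↦ rIV N sig 0 T ω :=
    measurable_rIV hc (fun t _ ↦ hN t) (measurable_uncurry_min_of_leftCont (fun t _ ↦ hs t)
      fun ω t ↦ (hsc ω).continuousWithinAt) measurable_const measurable_const
      (fun _ ↦ zero_le) fun _ ↦ le_rfl
  have hJjm (j : Fin M) : Measurable fun ω ↦ rIV N sig (τ j.castSucc ω) (τ j.succ ω) ω :=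
    measurable_rIV hc (fun t _ ↦ hN t) (measurable_uncurry_min_of_leftCont (fun t _ ↦ hs t)
      fun ω t ↦ (hsc ω).continuousWithinAt) ((hτm _).mono hFm le_rfl) ((hτm _).mono hFm le_rfl)
      (hτ.le _) (hτ.le _)
  have hIF : Measurable[latentInfo lam sig T] (IV lam sig 0 T) := measurable_IV hlj hsj
    measurable_const measurable_const (fun _ ↦ zero_le) fun _ ↦ le_rfl
  have hQF : Measurable[latentInfo lam sig T] (IQ lam sig 0 T) := measurable_IQ hlj hsj
    measurable_const measurable_const (fun _ ↦ zero_le) fun _ ↦ le_rfl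
  have hIjF (j : Fin M) : Measurable[latentInfo lam sig T]
      fun ω ↦ IV lam sig (τ j.castSucc ω) (τ j.succ ω) ω :=
    measurable_IV hlj hsj (hτm _) (hτm _) (hstep j) (hτ.le _)
  have hQjF (j : Fin M) : Measurable[latentInfo lam sig T]
      fun ω ↦ IQ lam sig (τ j.castSucc ω) (τ j.succ ω) ω :=
    measurable_IQ hlj hsj (hτm _) (hτm _) (hstep j) (hτ.le _)
  have hI0 {s t : ℝ≥0} (hst : s ≤ t) (ω) : 0 ≤ IV lam sig s t ω :=
    intervalIntegral.integral_nonneg (NNReal.coe_le_coe.2 hst) fun r _ ↦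
      mul_nonneg (sq_nonneg _) (hpos _ _).le
  have hQ0 {s t : ℝ≥0} (hst : s ≤ t) (ω) : 0 ≤ IQ lam sig s t ω :=
    intervalIntegral.integral_nonneg (NNReal.coe_le_coe.2 hst) fun r _ ↦
      mul_nonneg (by positivity) (hpos _ _).le
  have hJ0 (s t : ℝ≥0) (ω) : 0 ≤ rIV N sig s t ω := by
    rw [rIV, jumpIntegral]
    exact Finset.sum_nonneg fun i _ ↦ sq_nonneg (sig (arrivalTime N i ω) ω)
  have hQsum (ω) : ∑ j : Fin M, IQ lam sig (τ j.castSucc ω) (τ j.succ ω) ω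
      = IQ lam sig 0 T ω := by
    have hcont : Continuous fun r : ℝ ↦ sig r.toNNReal ω ^ 4 * lam r.toNNReal ω :=
      (((hsc ω).comp continuous_real_toNNReal).pow 4).mul
        ((h.lam_continuous ω).comp continuous_real_toNNReal)
    have := sum_succ_sub_castSucc fun j ↦ IQ lam sig 0 (τ j ω) ω
    simp only [hτ.first, hτ.last] at this
    have h0 : IQ lam sig 0 0 ω = 0 := intervalIntegral.integral_same
    rw [h0, sub_zero] at this
    rw [← this]
    refine Finset.sum_congr rfl fun j _ ↦ ?_
    exact (intervalIntegral.integral_interval_sub_left (hcont.intervalIntegrable _ _)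
      (hcont.intervalIntegrable _ _)).symm
  let I : Ω → ℝ≥0∞ := fun ω ↦ ENNReal.ofReal (IV lam sig 0 T ω)
  let J : Ω → ℝ≥0∞ := fun ω ↦ ENNReal.ofReal (rIV N sig 0 T ω)
  let X : Ω → ℝ≥0∞ := fun ω ↦ ENNReal.ofReal ((rIV N sig 0 T ω - IV lam sig 0 T ω) ^ 2
          + 2 * ∑ j : Fin M, rIV N sig (τ j.castSucc ω) (τ j.succ ω) ω ^ 2)
  let R : Ω → ℝ≥0∞ := fun ω ↦ ENNReal.ofReal (3 * IQ lam sig 0 T ω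
            + 2 * ∑ j : Fin M, IV lam sig (τ j.castSucc ω) (τ j.succ ω) ω ^ 2)
  have hIm' : Measurable[latentInfo lam sig T] I := hIF.ennreal_ofReal
  have hRm : Measurable[latentInfo lam sig T] R := by
    refine Measurable.ennreal_ofReal ((hQF.const_mul 3).add (Measurable.const_mul ?_ 2))
    exact Finset.measurable_fun_sum _ fun j _ ↦ (hIjF j).pow_const 2
  have hXJ (ω) : X ω + 2 * (I ω * J ω) = J ω ^ 2 + (I ω ^ 2
      + 2 * ∑ j : Fin M, ENNReal.ofReal (rIV N sig (τ j.castSucc ω) (τ j.succ ω) ω) ^ 2) := by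
    have hI := hI0 (zero_le : 0 ≤ T) ω
    have hJ := hJ0 0 T ω
    simp only [X, I, J, ← ENNReal.ofReal_pow hI, ← ENNReal.ofReal_pow (hJ0 _ _ ω),
      ← ENNReal.ofReal_mul hI, ← ENNReal.ofReal_sum_of_nonneg fun _ _ ↦ sq_nonneg _]
    rw [← ENNReal.ofReal_ofNat, ← ENNReal.ofReal_mul (by norm_num),
      ← ENNReal.ofReal_mul (by norm_num),
      ← ENNReal.ofReal_add (by positivity) (by positivity),
      ← ENNReal.ofReal_add (by positivity) (by positivity),
      ← ENNReal.ofReal_add (by positivity) (by positivity)]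
    congr 1
    ring
  have hRI (ω) : R ω + 2 * (I ω * I ω) = (I ω ^ 2 + ENNReal.ofReal (IQ lam sig 0 T ω)) + (I ω ^ 2
      + 2 * ∑ j : Fin M, (ENNReal.ofReal (IV lam sig (τ j.castSucc ω) (τ j.succ ω) ω) ^ 2
        + ENNReal.ofReal (IQ lam sig (τ j.castSucc ω) (τ j.succ ω) ω))) := by
    have hI := hI0 (zero_le : 0 ≤ T) ω
    have hQ := hQ0 (zero_le : 0 ≤ T) ω
    rw [Finset.sum_add_distrib,
      ← ENNReal.ofReal_sum_of_nonneg fun j _ ↦ hQ0 (hstep j ω) ω, hQsum]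
    simp only [R, I, ← ENNReal.ofReal_pow hI, ← ENNReal.ofReal_pow (hI0 (hstep _ ω) ω),
      ← ENNReal.ofReal_mul hI, ← ENNReal.ofReal_sum_of_nonneg fun _ _ ↦ sq_nonneg _]
    rw [← ENNReal.ofReal_add (by positivity) hQ, ← ENNReal.ofReal_add (by positivity) hQ,
      ← ENNReal.ofReal_ofNat, ← ENNReal.ofReal_mul (by norm_num),
      ← ENNReal.ofReal_mul (by norm_num),
      ← ENNReal.ofReal_add (by positivity) (by positivity),
      ← ENNReal.ofReal_add (by positivity) (by positivity),
      ← ENNReal.ofReal_add (by positivity) (by positivity)]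
    congr 1
    ring
  have hmul (S : Set Ω) (f : Ω → ℝ≥0∞) (hS : MeasurableSet[latentInfo lam sig T] S) :
      ∫⁻ ω in S, f ω ∂μ = ∫⁻ ω, S.indicator 1 ω * f ω ∂μ := by
    rw [← lintegral_indicator (hFm _ hS)]
    refine lintegral_congr fun ω ↦ ?_
    by_cases hω : ω ∈ S <;> simp [hω]
  have hind1 {S : Set Ω} (hS : MeasurableSet[latentInfo lam sig T] S) :
      Measurable[latentInfo lam sig T] (S.indicator 1 : Ω → ℝ≥0∞) :=
    Measurable.indicator measurable_const hS
  have hIm : Measurable I := hIm'.mono hFm le_rfl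
  have hJm' : Measurable J := hJm.ennreal_ofReal
  have key {S : Set Ω} (hS : MeasurableSet[latentInfo lam sig T] S) :
      ∫⁻ ω in S, (X ω + 2 * (I ω * J ω)) ∂μ = ∫⁻ ω in S, (R ω + 2 * (I ω * I ω)) ∂μ := by
    have h0 : ∫⁻ ω in S, J ω ^ 2 ∂μ
        = ∫⁻ ω in S, (I ω ^ 2 + ENNReal.ofReal (IQ lam sig 0 T ω)) ∂μ := by
      rw [hmul _ _ hS, hmul _ _ hS]
      exact (h.lintegral_mul_rIV hc hl hN hpos hs hsc hind measurable_const measurable_const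
        (fun _ ↦ zero_le) (fun _ ↦ le_rfl) (hind1 hS)).2
    have hj (j : Fin M) : ∫⁻ ω in S,
          ENNReal.ofReal (rIV N sig (τ j.castSucc ω) (τ j.succ ω) ω) ^ 2 ∂μ
        = ∫⁻ ω in S, (ENNReal.ofReal (IV lam sig (τ j.castSucc ω) (τ j.succ ω) ω) ^ 2
          + ENNReal.ofReal (IQ lam sig (τ j.castSucc ω) (τ j.succ ω) ω)) ∂μ := by
      rw [hmul _ _ hS, hmul _ _ hS]
      exact (h.lintegral_mul_rIV hc hl hN hpos hs hsc hind (hτm _) (hτm _)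
        (hstep j) (hτ.le _) (hind1 hS)).2
    have hIj (j : Fin M) := (hIjF j).mono hFm le_rfl
    have hQj (j : Fin M) := (hQjF j).mono hFm le_rfl
    have hQ := hQF.mono hFm le_rfl
    have expand {f g : Ω → ℝ≥0∞} {k : Fin M → Ω → ℝ≥0∞} (hf : Measurable f) (hg : Measurable g)
        (hk : ∀ j, Measurable (k j)) : ∫⁻ ω in S, (f ω + (g ω + 2 * ∑ j, k j ω)) ∂μ
          = ∫⁻ ω in S, f ω ∂μ + (∫⁻ ω in S, g ω ∂μ + 2 * ∑ j, ∫⁻ ω in S, k j ω ∂μ) := by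
      rw [lintegral_add_left hf, lintegral_add_left hg, lintegral_const_mul _ (by fun_prop),
        lintegral_finsetSum _ fun j _ ↦ hk j]
    rw [lintegral_congr hXJ, lintegral_congr hRI,
      expand (f := fun ω ↦ J ω ^ 2) (by fun_prop) (by fun_prop) (by fun_prop),
      expand (f := fun ω ↦ I ω ^ 2 + ENNReal.ofReal (IQ lam sig 0 T ω)) (by fun_prop)
        (by fun_prop) (by fun_prop), h0, Finset.sum_congr rfl fun j _ ↦ hj j]
  have key2 {S : Set Ω} (hS : MeasurableSet[latentInfo lam sig T] S) :
      ∫⁻ ω in S, 2 * (I ω * J ω) ∂μ = ∫⁻ ω in S, 2 * (I ω * I ω) ∂μ := by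
    rw [lintegral_const_mul _ (by fun_prop), lintegral_const_mul _ (by fun_prop), hmul _ _ hS,
      hmul _ _ hS]
    simp only [← mul_assoc]
    congr 1
    exact (h.lintegral_mul_rIV hc hl hN hpos hs hsc hind measurable_const measurable_const
      (fun _ ↦ zero_le) (fun _ ↦ le_rfl) ((hind1 hS).mul hIm')).1
  have e1 : μ⁻[X + fun ω ↦ 2 * (I ω * J ω) | latentInfo lam sig T]
      =ᵐ[μ] μ⁻[R + fun ω ↦ 2 * (I ω * I ω) | latentInfo lam sig T] :=
    condLExp_congr_of_setLIntegral_eq hFm fun S hS ↦ key hS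
  have e2 : μ⁻[fun ω ↦ 2 * (I ω * J ω) | latentInfo lam sig T]
      =ᵐ[μ] μ⁻[fun ω ↦ 2 * (I ω * I ω) | latentInfo lam sig T] :=
    condLExp_congr_of_setLIntegral_eq hFm fun S hS ↦ key2 hS
  have hIIm : Measurable[latentInfo lam sig T] fun ω ↦ 2 * (I ω * I ω) := (hIm'.mul hIm').const_mul 2
  rw [condLExp_eq_self hFm μ hIIm] at e2
  rw [condLExp_eq_self hFm μ (hRm.add hIIm)] at e1
  have e3 := condLExp_add_right (mΩ := latentInfo lam sig T) X (Y := fun ω ↦ 2 * (I ω * J ω)) (P := μ) (by fun_prop)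
  filter_upwards [e1, e2, e3] with ω h1 h2 h3
  rw [h3, Pi.add_apply, h2, Pi.add_apply] at h1
  -- Cancellation is legitimate because the projected cross term is 2 IV², which is finite at every
  -- ω.
  exact (ENNReal.add_left_inj (by finiteness)).1 h1

end Moments

end TTSV

/-- The squared error `(RV - IV)²` is nonnegative but need not be integrable under the stated
moment conditions, so its conditional expectation is the one for `[0,∞]`-valued variables
(`condLExp`); it agrees with `condExp` whenever the squared error is integrable. -/
theorem mainTheorem1 {Ω : Type*} {mΩ : MeasurableSpace Ω} (μ : Measure Ω) [IsProbabilityMeasure μ]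
    (T : ℝ≥0) {m : ℕ} (Z : ℝ≥0 → Ω → Fin m → ℝ) (hZ : ∀ t, StronglyMeasurable (Z t))
    (B : ℝ≥0 → Ω → ℝ) (N : ℝ≥0 → Ω → ℕ) (lam sig P : ℝ≥0 → Ω → ℝ)
    (hmodel : TTSV.IsTTSVModel μ T Z hZ B N lam sig P)
    (hindep : TTSV.IndependentDriver μ B N lam sig)
    (hmoments : TTSV.MomentConditions μ (Filtration.natural Z hZ) T lam sig)
    {M : ℕ} (τ : Fin (M + 1) → Ω → ℝ≥0) (hτ : TTSV.IsSamplingGrid T τ) :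
    ((∀ j, Measurable[TTSV.realizedInfo lam sig N T] (τ j)) →
      μ⁻[fun ω => ENNReal.ofReal ((TTSV.RV P τ ω - TTSV.IV lam sig 0 T ω) ^ 2)
          | TTSV.realizedInfo lam sig N T]
        =ᵐ[μ] fun ω => ENNReal.ofReal
          ((TTSV.rIV N sig 0 T ω - TTSV.IV lam sig 0 T ω) ^ 2
            + 2 * ∑ j : Fin M, TTSV.rIV N sig (τ j.castSucc ω) (τ j.succ ω) ω ^ 2)) ∧
    (TTSV.IsDoublyStochasticPoisson μ N lam →
      IndepFun (fun ω t => (lam t ω, N t ω)) (fun ω t => sig t ω) μ →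
      (∀ j, Measurable[TTSV.latentInfo lam sig T] (τ j)) →
      μ⁻[fun ω => ENNReal.ofReal ((TTSV.RV P τ ω - TTSV.IV lam sig 0 T ω) ^ 2)
          | TTSV.latentInfo lam sig T]
        =ᵐ[μ] fun ω => ENNReal.ofReal
          (3 * TTSV.IQ lam sig 0 T ω
            + 2 * ∑ j : Fin M, TTSV.IV lam sig (τ j.castSucc ω) (τ j.succ ω) ω ^ 2)) := by
  have hl (t) : Measurable (lam t) :=
    (hmodel.lam_predictable.stronglyAdapted t).measurable.mono
      ((Filtration.natural Z hZ).le t) le_rfl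
  have hs (t) : Measurable (sig t) :=
    (hmodel.sig_predictable.stronglyAdapted t).measurable.mono
      ((Filtration.natural Z hZ).le t) le_rfl
  have hN (t) : Measurable (N t) :=
    (hmodel.N_adapted t).mono ((Filtration.natural Z hZ).le t) le_rfl
  have hle := TTSV.realizedInfo_le (T := T) hl hs hN
  have hint {S : Set Ω} (hτm : ∀ j, Measurable[TTSV.realizedInfo lam sig N T] (τ j))
      (hS : MeasurableSet[TTSV.realizedInfo lam sig N T] S) :=
    TTSV.setLIntegral_sq_RV_sub_IV hmodel.counting hl hs hN hmodel.lam_leftCont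
      hmodel.sig_continuous hmodel.B_measurable hmodel.B_brownian hmodel.price hindep hτ hτm hS
  refine ⟨fun hτm ↦ ?_, fun hdspp hind hτm ↦ ?_⟩
  · refine (ae_eq_condLExp hle μ _ ?_ fun S hS ↦ (hint hτm hS).symm).symm
    have hsj := TTSV.measurable_uncurry_min_of_leftCont
      (fun t (ht : t ≤ T) ↦ (TTSV.measurable_realizedInfo (lam := lam) (N := N) ht).2.1)
      fun ω t ↦ (hmodel.sig_continuous ω).continuousWithinAt
    have hlj := TTSV.measurable_uncurry_min_of_leftCont
      (fun t (ht : t ≤ T) ↦ (TTSV.measurable_realizedInfo (sig := sig) (N := N) ht).1)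
      hmodel.lam_leftCont
    have hr {a b : Ω → ℝ≥0} (ha : Measurable[TTSV.realizedInfo lam sig N T] a)
        (hb : Measurable[TTSV.realizedInfo lam sig N T] b) (haT : ∀ ω, a ω ≤ T)
        (hbT : ∀ ω, b ω ≤ T) :=
      TTSV.measurable_rIV hmodel.counting
        (fun t ht ↦ (TTSV.measurable_realizedInfo ht).2.2) hsj ha hb haT hbT
    have hI := TTSV.measurable_IV hlj hsj measurable_const measurable_const
      (fun _ ↦ zero_le) fun _ ↦ le_refl T
    have hr0 := hr measurable_const measurable_const (fun _ ↦ zero_le) fun _ ↦ le_refl T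
    exact (((hr0.sub hI).pow_const 2).add (Measurable.const_mul (Finset.measurable_fun_sum _
      fun j _ ↦ (hr (hτm _) (hτm _) (hτ.le _) (hτ.le _)).pow_const 2) 2)).ennreal_ofReal
  · have hle' := TTSV.latentInfo_le_realizedInfo (lam := lam) (sig := sig) (N := N) (T := T)
    -- Tower property: latent events are realized events, so the squared error and the right side of
    -- (a) have the same latent projection.
    exact (TTSV.condLExp_congr_of_setLIntegral_eq (hle'.trans hle) fun S hS ↦
      hint (fun j ↦ (hτm j).mono hle' le_rfl) (hle' _ hS)).trans
      (hdspp.condLExp_sq_rIV_sub_IV hmodel.counting hl hN hmodel.lam_pos hs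
        hmodel.sig_continuous hind hτ hτm)
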